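/- Let $G$ be one of the complex classical groups $SL(N+1)$ $(N\ge 0)$, $SO(2N)$ $(N\ge 1)$, $SO(2N+1)$ $(N\ge 0)$, $Sp(N)$ $(N\ge 1)$, viewed as a group of $n\times n$ matrices through its standard representation $\mathbb{C}^n$. Let $\mathbb{V},\mathbb{W}$ be finite dimensional complex rational representations of $G$, each equipped with a Hermitian norm, and let $0\neq v\in\mathbb{V}$, $0\neq w\in\mathbb{W}$. For a maximal algebraic torus $T\le G$ with character lattice $M_{\mathbb{Z}}$, and a vector $u\ne 0$ in a rational representation of $G$, the weight polytope $\mathcal{N}(u)\subset M_{\mathbb{R}}=M_{\mathbb{Z}}\otimes\mathbb{R}$ is the convex hull of the characters $a\in M_{\mathbb Z}$ for which the component of $u$ in the $a$-weight space of $T$ is nonzero. Let $G$ act on the space $\mathcal{GL}(n,\mathbb{C})$ of all $n\times n$ matrices by left multiplication, let $\mathbb{I}$ be the identity matrix and $Q=\mathcal{N}(\mathbb{I})$. The degree $\deg(\mathbb{V})$ is the least positive integer $k$ such that $\mathcal{N}(u)\subseteq kQ$ for all $0\neq u\in\mathbb{V}$; it does not depend on $T$. For two rational representations $\mathbb{V}',\mathbb{W}'$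 and nonzero $v'\in\mathbb{V}'$, $w'\in\mathbb{W}'$, the pair $(v',w')$ is called *semistable* if the Zariski closures in $\mathbb{P}(\mathbb{V}'\oplus\mathbb{W}')$ of the orbits $G\cdot[(v',w')]$ and $G\cdot[(v',0)]$ are disjoint. The pair $(v,w)$ is called *stable* if there is an integer $m>0$ such that $(\mathbb{I}^{\otimes q}\otimes v^{\otimes m},\,w^{\otimes(m+1)})$ is semistable, where $q=\deg(\mathbb{V})$. The energy of the pair is $p_{vw}(\sigma)=\log\|\sigma\cdot w\|^2-\log\|\sigma\cdot v\|^2$ for $\sigma\in G$. Fix a Hermitian metric on $\mathbb{C}^n$, and let $\|\cdot\|_{hs}$ be the associated Hilbert-Schmidt norm on $n\times n$ matrices. The energy $p_{vw}$ is called *proper* if there are an integer $m>0$ and a constant $B\in\mathbb{R}$ such that $$p_{vw}(\sigma)+\frac{1}{m+1}\log\|\sigma\cdot v\|^2\ \ge\ \frac{\deg(\mathbb{V})}{m+1}\log\|\sigma\|_{hs}^2+B\qquad\text{for all }\sigma\in G.$$ **Theorem.** The pair $(v,w)$ is stable if and only if its energy $p_{vw}$ is proper. -/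

import Mathlib

open scoped TensorProduct LinearAlgebra.Projectivization ComplexOrder

noncomputable section

namespace StablePair

/-! ### Classical groups -/

/-- The complex special orthogonal group, inside `SL n ℂ`. -/
def specialOrthogonal (n : Type) [Fintype n] [DecidableEq n] :
    Subgroup (Matrix.SpecialLinearGroup n ℂ) where
  carrier := {A | (A : Matrix n n ℂ) ∈ Matrix.orthogonalGroup n ℂ}
  one_mem' := by simp
  mul_mem' {A B} hA hB := by
    simpa using Submonoid.mul_mem (Matrix.orthogonalGroup n ℂ) hA hB
  inv_mem' {A} hA := by
    simp only [Set.mem_ofPred_eq, Matrix.mem_orthogonalGroup_iff] at hA ⊢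
    have h1 : ((A⁻¹ : Matrix.SpecialLinearGroup n ℂ) : Matrix n n ℂ)
        = (A : Matrix n n ℂ).transpose := by
      have h2 : ((A⁻¹ : Matrix.SpecialLinearGroup n ℂ) : Matrix n n ℂ) * (A : Matrix n n ℂ) = 1 := by
        rw [← Matrix.SpecialLinearGroup.coe_mul, inv_mul_cancel, Matrix.SpecialLinearGroup.coe_one]
      exact left_inv_eq_right_inv h2 hA
    rw [h1, Matrix.transpose_transpose]
    exact mul_eq_one_comm.mp hA

/-- The complex symplectic group of rank `N`, inside `SL (2N) ℂ`. (A symplectic matrix always has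
determinant one, so this is the full symplectic group.) -/
def symplectic (N : ℕ) : Subgroup (Matrix.SpecialLinearGroup (Fin N ⊕ Fin N) ℂ) where
  carrier := {A | (A : Matrix (Fin N ⊕ Fin N) (Fin N ⊕ Fin N) ℂ) ∈ Matrix.symplecticGroup (Fin N) ℂ}
  one_mem' := by
    simp
  mul_mem' {A B} hA hB := by
    simpa using Submonoid.mul_mem (Matrix.symplecticGroup (Fin N) ℂ) hA hB
  inv_mem' {A} hA := by
    simp only [Set.mem_ofPred_eq] at hA ⊢
    have h2 : (A : Matrix (Fin N ⊕ Fin N) (Fin N ⊕ Fin N) ℂ) *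
        ((A⁻¹ : Matrix.SpecialLinearGroup (Fin N ⊕ Fin N) ℂ) : Matrix _ _ ℂ) = 1 := by
      rw [← Matrix.SpecialLinearGroup.coe_mul, mul_inv_cancel, Matrix.SpecialLinearGroup.coe_one]
    have h3 : (((⟨A, hA⟩ : Matrix.symplecticGroup (Fin N) ℂ)⁻¹ :
        Matrix.symplecticGroup (Fin N) ℂ) : Matrix (Fin N ⊕ Fin N) (Fin N ⊕ Fin N) ℂ) *
        (A : Matrix (Fin N ⊕ Fin N) (Fin N ⊕ Fin N) ℂ) = 1 :=
      congrArg Subtype.val (inv_mul_cancel (⟨A, hA⟩ : Matrix.symplecticGroup (Fin N) ℂ))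
    rw [← left_inv_eq_right_inv h3 h2]
    exact Subtype.property _

/-- The classical groups `SL(N+1)`, `SO(2N)`, `SO(2N+1)`, `Sp(N)` over `ℂ`, each given together
with its standard representation (as a group of matrices). -/
inductive IsClassicalGroup : {n : Type} → [Fintype n] → [DecidableEq n] →
    Subgroup (Matrix.SpecialLinearGroup n ℂ) → Prop
  | sl (N : ℕ) :
      IsClassicalGroup (⊤ : Subgroup (Matrix.SpecialLinearGroup (Fin (N + 1)) ℂ))
  | soEven (N : ℕ) (hN : 0 < N) : IsClassicalGroup (specialOrthogonal (Fin (2 * N)))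
  | soOdd (N : ℕ) : IsClassicalGroup (specialOrthogonal (Fin (2 * N + 1)))
  | sp (N : ℕ) (hN : 0 < N) : IsClassicalGroup (symplectic N)

variable {n : Type} [Fintype n] [DecidableEq n] {G : Subgroup (Matrix.SpecialLinearGroup n ℂ)}

/-! ### Regular functions and rational representations -/

/-- The value of a polynomial in the matrix entries at an element of `G`. -/
def evalEntries (P : MvPolynomial (n × n) ℂ) (g : G) : ℂ :=
  MvPolynomial.eval (fun ij => ((g : Matrix.SpecialLinearGroup n ℂ) : Matrix n n ℂ) ij.1 ij.2) P

/-- A representation of `G` is rational if all its matrix coefficients are regular functions on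
`G`. As `G` is a closed subgroup of `SL n ℂ`, these are the restrictions of polynomials in the
matrix entries. -/
def IsRational {V : Type*} [AddCommGroup V] [Module ℂ V] (ρ : Representation ℂ G V) : Prop :=
  ∀ (φ : Module.Dual ℂ V) (v : V), ∃ P : MvPolynomial (n × n) ℂ, ∀ g : G,
    φ (ρ g v) = evalEntries P g

/-- A subgroup `T` of `G` is an algebraic torus if it is isomorphic, as an algebraic group, to
`(ℂˣ)^r` for some `r`: the matrix entries are Laurent polynomials in the coordinates
`t₁, …, t_r`, and the coordinates are polynomials in the matrix entries. -/
def IsTorus (T : Subgroup G) : Prop :=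
  ∃ (r : ℕ) (φ : (Fin r → ℂˣ) ≃* T),
    (∀ i j : n, ∃ Q : MvPolynomial (Fin r ⊕ Fin r) ℂ, ∀ t : Fin r → ℂˣ,
      (((φ t : G) : Matrix.SpecialLinearGroup n ℂ) : Matrix n n ℂ) i j =
        MvPolynomial.eval (Sum.elim (fun k => (t k : ℂ)) (fun k => ((t k)⁻¹ : ℂ))) Q) ∧
    (∀ k : Fin r, ∃ P : MvPolynomial (n × n) ℂ, ∀ t : T,
      (φ.symm t k : ℂ) = evalEntries P (t : G))

/-- A maximal algebraic torus of `G`. -/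
def IsMaximalTorus (T : Subgroup G) : Prop :=
  IsTorus T ∧ ∀ T' : Subgroup G, IsTorus T' → T ≤ T' → T' = T

/-! ### Characters, weights and the degree -/

/-- The polynomial obtained from `P` by substituting the entries of the inverse matrix. -/
lemma exists_evalEntries_inv (P : MvPolynomial (n × n) ℂ) :
    ∃ P' : MvPolynomial (n × n) ℂ, ∀ g : G, evalEntries P' g = evalEntries P g⁻¹ := by
  refine ⟨MvPolynomial.bind₁
    (fun ij => (Matrix.mvPolynomialX n n ℂ).adjugate ij.1 ij.2) P, fun g => ?_⟩
  unfold evalEntries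
  rw [← MvPolynomial.coe_aeval_eq_eval, ← MvPolynomial.coe_aeval_eq_eval]
  simp only [RingHom.coe_coe]
  rw [MvPolynomial.aeval_bind₁]
  congr 1
  congr 1
  funext ij
  have h := RingHom.map_adjugate (MvPolynomial.eval
    (fun ij : n × n => ((g : Matrix.SpecialLinearGroup n ℂ) : Matrix n n ℂ) ij.1 ij.2))
    (Matrix.mvPolynomialX n n ℂ)
  rw [Matrix.mvPolynomialX_mapMatrix_eval] at h
  rw [Subgroup.coe_inv, Matrix.SpecialLinearGroup.coe_inv, ← h]
  rfl

/-- The character lattice `Hom(T, ℂˣ)` (homomorphisms of algebraic groups), written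
multiplicatively. -/
def characterLattice (T : Subgroup G) : Subgroup (T →* ℂˣ) where
  carrier := {χ | ∃ P : MvPolynomial (n × n) ℂ, ∀ t : T, (χ t : ℂ) = evalEntries P (t : G)}
  one_mem' := ⟨1, fun t => by simp [evalEntries]⟩
  mul_mem' := by
    rintro a b ⟨P, hP⟩ ⟨Q, hQ⟩
    exact ⟨P * Q, fun t => by simp [evalEntries, hP, hQ]⟩
  inv_mem' := by
    rintro a ⟨P, hP⟩
    obtain ⟨P', hP'⟩ := exists_evalEntries_inv (G := G) P
    refine ⟨P', fun t => ?_⟩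
    rw [hP', MonoidHom.inv_apply, ← map_inv, hP, Subgroup.coe_inv]

/-- The real vector space `M_ℝ`, the character lattice with scalars extended to `ℝ`. -/
abbrev RealCharacters (T : Subgroup G) : Type :=
  ℝ ⊗[ℤ] Additive (characterLattice T)

/-- A character, seen as a point of `M_ℝ`. -/
def toRealCharacters (T : Subgroup G) (χ : characterLattice T) : RealCharacters T :=
  1 ⊗ₜ[ℤ] Additive.ofMul χ

section Weights

variable {V : Type*} [AddCommGroup V] [Module ℂ V]

/-- The weight space of the character `χ` of `T`. -/
def weightSpace (ρ : Representation ℂ G V) (T : Subgroup G) (χ : characterLattice T) :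
    Submodule ℂ V where
  carrier := {v | ∀ t : T, ρ (t : G) v = ((χ : T →* ℂˣ) t : ℂ) • v}
  zero_mem' := fun t => by simp
  add_mem' := fun ha hb t => by rw [map_add, ha t, hb t, smul_add]
  smul_mem' := fun c v hv t => by rw [map_smul, hv t, smul_comm]

/-- The `T`-support of `v`: the characters `χ` for which the component `f χ` of `v` in the weight
space of `χ` is nonzero. -/
def support (ρ : Representation ℂ G V) (T : Subgroup G) (v : V) : Set (characterLattice T) :=
  {χ | ∃ f : characterLattice T →₀ V,
    (∀ ψ, f ψ ∈ weightSpace ρ T ψ) ∧ (f.sum fun _ x => x) = v ∧ f χ ≠ 0}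

/-- The weight polytope of `v`. -/
def weightPolytope (ρ : Representation ℂ G V) (T : Subgroup G) (v : V) : Set (RealCharacters T) :=
  convexHull ℝ (toRealCharacters T '' support ρ T v)

end Weights

variable (G) in
/-- The left regular representation of `G` on the space of all square matrices. -/
def leftRegular : Representation ℂ G (Matrix n n ℂ) where
  toFun g := LinearMap.mulLeft ℂ ((g : Matrix.SpecialLinearGroup n ℂ) : Matrix n n ℂ)
  map_one' := by ext; simp
  map_mul' g h := by
    apply LinearMap.ext
    intro A
    simp

/-- The standard simplex: the weight polytope of the identity matrix. -/
def standardSimplex (T : Subgroup G) : Set (RealCharacters T) :=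
  weightPolytope (leftRegular G) T (1 : Matrix n n ℂ)

open scoped Pointwise in
/-- The degree of a representation: the least positive `k` such that the weight polytope of every
nonzero vector is contained in `k` times the standard simplex. -/
def degree {V : Type*} [AddCommGroup V] [Module ℂ V] (ρ : Representation ℂ G V) : ℕ :=
  sInf {k : ℕ | 0 < k ∧ ∀ T : Subgroup G, IsMaximalTorus T → ∀ v : V, v ≠ 0 →
    weightPolytope ρ T v ⊆ (k : ℝ) • standardSimplex T}

/-! ### Semistable and stable pairs -/

/-- The Zariski closure of a subset of the projective space of `E`: the common zero locus of all
homogeneous polynomials vanishing on it. Polynomials on `E` are written as polynomials in the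
linear forms on `E`. -/
def zariskiClosure {E : Type*} [AddCommGroup E] [Module ℂ E] (S : Set (ℙ ℂ E)) : Set (ℙ ℂ E) :=
  {y | ∀ (d : ℕ) (P : MvPolynomial (Module.Dual ℂ E) ℂ), P.IsHomogeneous d →
    (∀ x ∈ S, MvPolynomial.eval (fun φ => φ x.rep) P = 0) →
    MvPolynomial.eval (fun φ => φ y.rep) P = 0}

/-- The orbit `G · [u]` in the projective space of `E`. -/
def projectiveOrbit {E : Type*} [AddCommGroup E] [Module ℂ E] (ρ : Representation ℂ G E) (u : E) :
    Set (ℙ ℂ E) :=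
  {x | ∃ (g : G) (h : ρ g u ≠ 0), x = Projectivization.mk ℂ (ρ g u) h}

/-- The pair `(v, w)` is semistable if the Zariski closures of `G · [(v, w)]` and `G · [(v, 0)]`
in the projective space of `V ⊕ W` are disjoint. -/
def IsSemistablePair {V W : Type*} [AddCommGroup V] [Module ℂ V] [AddCommGroup W] [Module ℂ W]
    (ρ : Representation ℂ G V) (τ : Representation ℂ G W) (v : V) (w : W) : Prop :=
  zariskiClosure (projectiveOrbit (ρ.prod τ) (v, w)) ∩
    zariskiClosure (projectiveOrbit (ρ.prod τ) (v, 0)) = ∅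

/-- The `m`-th tensor power of a representation. -/
def tensorPower {V : Type*} [AddCommGroup V] [Module ℂ V] (ρ : Representation ℂ G V) (m : ℕ) :
    Representation ℂ G (⨂[ℂ]^m V) :=
  PiTensorProduct.mapMonoidHom.comp (MonoidHom.pi fun _ : Fin m => ρ)

/-- The vector `v ^ m = v ⊗ ⋯ ⊗ v`. -/
def vectorPower {V : Type*} [AddCommGroup V] [Module ℂ V] (v : V) (m : ℕ) : ⨂[ℂ]^m V :=
  PiTensorProduct.tprod ℂ fun _ : Fin m => v

/-- The pair `(v, w)` is stable if for some positive `m` the pair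
`(I ^ q ⊗ v ^ m, w ^ (m + 1))` is semistable, where `q` is the degree of `V`. -/
def IsStablePair {V W : Type*} [AddCommGroup V] [Module ℂ V] [AddCommGroup W] [Module ℂ W]
    (ρ : Representation ℂ G V) (τ : Representation ℂ G W) (v : V) (w : W) : Prop :=
  ∃ m : ℕ, 0 < m ∧
    IsSemistablePair
      ((tensorPower (leftRegular G) (degree ρ)).tprod (tensorPower ρ m))
      (tensorPower τ (m + 1))
      (vectorPower (1 : Matrix n n ℂ) (degree ρ) ⊗ₜ[ℂ] vectorPower v m)
      (vectorPower w (m + 1))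

/-! ### The energy of a pair -/

/-- The squared Hilbert-Schmidt norm of `A` with respect to the Hermitian metric on `ℂⁿ` with Gram
matrix `H`, that is, the trace of `A† A` where `A† = H⁻¹ Aᴴ H` is the adjoint of `A`. -/
def hsNormSq (H A : Matrix n n ℂ) : ℝ :=
  (H⁻¹ * A.conjTranspose * H * A).trace.re

section Energy

variable {V W : Type*} [NormedAddCommGroup V] [InnerProductSpace ℂ V]
  [NormedAddCommGroup W] [InnerProductSpace ℂ W]

/-- The energy `p_{vw}` of the pair `(v, w)`. -/
def energy (ρ : Representation ℂ G V) (τ : Representation ℂ G W) (v : V) (w : W) (σ : G) : ℝ :=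
  Real.log (‖τ σ w‖ ^ 2) - Real.log (‖ρ σ v‖ ^ 2)

/-- The energy `p_{vw}` is proper (with respect to the Hermitian metric `H` on the standard
representation). -/
def IsProperEnergy (H : Matrix n n ℂ) (ρ : Representation ℂ G V) (τ : Representation ℂ G W)
    (v : V) (w : W) : Prop :=
  ∃ m : ℕ, 0 < m ∧ ∃ B : ℝ, ∀ σ : G,
    energy ρ τ v w σ + 1 / ((m : ℝ) + 1) * Real.log (‖ρ σ v‖ ^ 2) ≥
      (degree ρ : ℝ) / ((m : ℝ) + 1) *
        Real.log (hsNormSq H ((σ : Matrix.SpecialLinearGroup n ℂ) : Matrix n n ℂ)) + B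

end Energy

end StablePair

end

noncomputable section

namespace StablePair

/-! ### Complex points of finitely generated algebras -/

section ComplexPoints

open PrimeSpectrum Topology

/-! Stability and properness, each for a fixed `m`, are the same norm inequality along the orbit:
some `C > 0` satisfies `C ‖σ‖^q ‖σv‖^m ≤ ‖σw‖^(m+1)` for all `σ` in `G`, where `q` is the degree and
enters only as an exponent. On the energy side this is exponentiation (`isProperEnergy_iff`). On the
algebraic side it is the principle that a pair is semistable exactly when `‖σw‖ / ‖σv‖` is bounded
away from zero (`isSemistablePair_iff`), applied to the tensor powers. Norms on a finite dimensional
space are equivalent, so sup norms of coordinates may be used there; they are multiplicative on pure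
tensors.

If the ratio is not bounded below, rescaled points of the orbit of `(v, w)` accumulate at some `(a,
0)` with `a ≠ 0`, which is also a limit of rescaled points of the orbit of `(v, 0)`, so the closures
meet. Conversely, a common point of the closures has the form `[(a, 0)]`. The affine cone over `G ·
[(v, w)]` is the image of the affine variety `ℂ × G` under a polynomial map, so its Zariski closure
lies in its Euclidean closure (`mem_closure_image_of_forall_eval_eq_zero`). The norm inequality is
homogeneous and closed, hence passes to `(a, 0)` and forces `a = 0`.

The comparison of closures has two ingredients. By Chevalley, a dominant map of irreducible
varieties hits a nonempty open set. By Noether normalization and continuity of roots, such an open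
set is dense in the Euclidean topology (`exists_seq_algHom_tendsto`). -/

lemma algHom_eq_of_ker_le {A : Type*} [CommRing A] [Algebra ℂ A] {x y : A →ₐ[ℂ] ℂ}
    (h : ∀ a, x a = 0 → y a = 0) : x = y := by
  ext a
  have := h (a - algebraMap ℂ A (x a)) (by simp)
  rw [map_sub, AlgHom.commutes, sub_eq_zero] at this
  exact this.symm

/-- Nullstellensatz: the residue field is finite over `ℂ`, hence equal to `ℂ`. -/
lemma exists_algHom_ker_eq {S : Type*} [CommRing S] [Algebra ℂ S] [Algebra.FiniteType ℂ S]
    (M : Ideal S) [M.IsMaximal] : ∃ φ : S →ₐ[ℂ] ℂ, RingHom.ker φ = M := by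
  let _ : Field (S ⧸ M) := Ideal.Quotient.field M
  have : Module.Finite ℂ (S ⧸ M) := finite_of_finite_type_of_isJacobsonRing ℂ (S ⧸ M)
  let e := AlgEquiv.ofBijective (Algebra.ofId ℂ (S ⧸ M))
    (IsAlgClosed.algebraMap_bijective_of_isIntegral (k := ℂ) (K := S ⧸ M))
  refine ⟨e.symm.toAlgHom.comp (Ideal.Quotient.mkₐ ℂ M), ?_⟩
  ext s
  simp [RingHom.mem_ker, Ideal.Quotient.eq_zero_iff_mem]

/-- In an irreducible space, a constructible set or its complement contains a nonempty open set. -/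
lemma _root_.Topology.IsConstructible.exists_isOpen_subset_or_subset_compl {X : Type*}
    [TopologicalSpace X] [PreirreducibleSpace X] [Nonempty X] {s : Set X} (hs : IsConstructible s) :
    (∃ U, IsOpen U ∧ U.Nonempty ∧ U ⊆ s) ∨ ∃ U, IsOpen U ∧ U.Nonempty ∧ U ⊆ sᶜ := by
  induction hs using IsConstructible.empty_union_induction with
  | open_retrocompact U hU _ =>
    by_cases h : U.Nonempty
    · exact .inl ⟨U, hU, h, subset_rfl⟩
    · rw [Set.not_nonempty_iff_eq_empty] at h
      exact .inr ⟨Set.univ, isOpen_univ, Set.univ_nonempty, by simp [h]⟩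
  | union s _ t _ hs ht =>
    rcases hs with ⟨U, hU, hU', hUs⟩ | ⟨U, hU, hU', hUs⟩
    · exact .inl ⟨U, hU, hU', hUs.trans Set.subset_union_left⟩
    rcases ht with ⟨V, hV, hV', hVt⟩ | ⟨V, hV, hV', hVt⟩
    · exact .inl ⟨V, hV, hV', hVt.trans Set.subset_union_right⟩
    refine .inr ⟨U ∩ V, hU.inter hV, nonempty_preirreducible_inter hU hV hU' hV', ?_⟩
    rw [Set.compl_union]
    exact Set.inter_subset_inter hUs hVt
  | compl s _ hs => rw [compl_compl]; exact hs.symm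

/-- The generic complex point of a domain lifts along an injective map of finitely generated
algebras. -/
lemma exists_ne_zero_forall_exists_lift {A S : Type*} [CommRing A] [IsDomain A] [Algebra ℂ A]
    [Algebra.FiniteType ℂ A] [CommRing S] [IsDomain S] [Algebra ℂ S] [Algebra.FiniteType ℂ S]
    (f : A →ₐ[ℂ] S) (hf : Function.Injective f) :
    ∃ a : A, a ≠ 0 ∧ ∀ x : A →ₐ[ℂ] ℂ, x a ≠ 0 → ∃ y : S →ₐ[ℂ] ℂ, y.comp f = x := by
  have : IsNoetherianRing A := Algebra.FiniteType.isNoetherianRing ℂ A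
  have hfp : (f : A →+* S).FinitePresentation := by
    rw [← RingHom.FinitePresentation.of_finiteType]
    refine RingHom.FiniteType.of_comp_finiteType (f := algebraMap ℂ A) ?_
    rw [AlgHom.comp_algebraMap_of_tower]
    exact (RingHom.finiteType_algebraMap).2 inferInstance
  -- The generic point is in the image, by injectivity, and in every nonempty open set. So of the
  -- two alternatives for the constructible image, its complement cannot contain a nonempty open
  -- set.
  let η : PrimeSpectrum A := ⟨⊥, Ideal.isPrime_bot⟩
  have hη : η ∈ Set.range (PrimeSpectrum.comap (f : A →+* S)) := by
    refine ⟨⟨⊥, Ideal.isPrime_bot⟩, ?_⟩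
    ext1
    exact (RingHom.injective_iff_ker_eq_bot _).1 hf
  have hopen : ∀ U : Set (PrimeSpectrum A), IsOpen U → U.Nonempty → η ∈ U := by
    rintro U hU ⟨p, hp⟩
    exact ((PrimeSpectrum.le_iff_specializes η p).1 bot_le).mem_open hU hp
  rcases (isConstructible_range_comap hfp).exists_isOpen_subset_or_subset_compl with
    ⟨U, hU, hU', hUs⟩ | ⟨U, hU, hU', hUs⟩
  swap
  · exact absurd hη (hUs (hopen U hU hU'))
  obtain ⟨_, ⟨_, ⟨a, rfl⟩, rfl⟩, ha, haU⟩ :=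
    isBasis_basic_opens.exists_subset_of_mem_open (hopen U hU hU') hU
  refine ⟨a, fun h => ha (by simp [h]), fun x hx => ?_⟩
  obtain ⟨P, hP⟩ := hUs (haU (show (⟨RingHom.ker x, RingHom.ker_isPrime x⟩ : PrimeSpectrum A) ∈ _
    from hx))
  -- `P` need not be a closed point. Enlarging it to `M` keeps the contraction, because the kernel
  -- of `x` is already maximal.
  obtain ⟨M, hM, hPM⟩ := Ideal.exists_le_maximal P.asIdeal P.2.ne_top
  obtain ⟨y, hy⟩ := exists_algHom_ker_eq M
  refine ⟨y, (algHom_eq_of_ker_le fun b hb => ?_).symm⟩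
  have hb' : b ∈ (PrimeSpectrum.comap (f : A →+* S) P).asIdeal := by rw [hP]; exact hb
  have : f b ∈ RingHom.ker y := hy ▸ hPM hb'
  exact this

lemma isRoot_minpoly_map {B A : Type*} [CommRing B] [Algebra ℂ B] [CommRing A] [Algebra ℂ A]
    [Algebra B A] (z : B →ₐ[ℂ] ℂ) (x : A →ₐ[ℂ] ℂ) (hx : ∀ b, x (algebraMap B A b) = z b)
    (f : A) : ((minpoly B f).map (z : B →+* ℂ)).IsRoot (x f) := by
  have h := congrArg x (minpoly.aeval B f)
  rw [map_zero, Polynomial.aeval_def, ← AlgHom.coe_toRingHom, Polynomial.hom_eval₂] at h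
  rw [Polynomial.IsRoot, Polynomial.eval_map, ← h]
  congr 1
  ext b
  exact (hx b).symm

/-- A point is determined by its values on finitely many generators, and each value is a root of a
monic polynomial depending only on `z`. -/
lemma finite_fiber {B A : Type*} [CommRing B] [Algebra ℂ B] [CommRing A] [Algebra ℂ A]
    [Algebra.FiniteType ℂ A] [Algebra B A] [Algebra.IsIntegral B A] (z : B →ₐ[ℂ] ℂ) :
    {x : A →ₐ[ℂ] ℂ | ∀ b, x (algebraMap B A b) = z b}.Finite := by
  obtain ⟨s, hs⟩ := Algebra.FiniteType.out (R := ℂ) (A := A)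
  let Φ : (A →ₐ[ℂ] ℂ) → (s → ℂ) := fun x t => x t
  have hΦ : Function.Injective Φ := by
    intro x y hxy
    refine AlgHom.ext_of_adjoin_eq_top hs fun t ht => congrFun hxy ⟨t, ht⟩
  refine Set.Finite.of_finite_image (f := Φ) ?_ hΦ.injOn
  refine (Set.Finite.pi' (t := fun t : s => {c : ℂ | ((minpoly B (t : A)).map
    (z : B →+* ℂ)).IsRoot c}) fun t => ?_).subset ?_
  · refine Polynomial.finite_setOfPred_isRoot ?_
    exact ((minpoly.monic (Algebra.IsIntegral.isIntegral (t : A))).map _).ne_zero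
  · rintro _ ⟨x, hx, rfl⟩ t
    exact isRoot_minpoly_map z x hx _

/-! ### Points of an integral extension of an integrally closed domain -/

section Integral

variable {B A : Type*} [CommRing B] [IsDomain B] [IsIntegrallyClosed B] [Algebra ℂ B]
  [CommRing A] [IsDomain A] [Algebra ℂ A] [Algebra.FiniteType ℂ A] [Algebra B A]
  [IsScalarTower ℂ B A] [Algebra.IsIntegral B A] [FaithfulSMul B A]

/-- A root of the specialised minimal polynomial of `f` is a value of `f` on the fibre. -/
lemma exists_algHom_of_isRoot_minpoly (z : B →ₐ[ℂ] ℂ) (f : A) (r : ℂ)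
    (hr : ((minpoly B f).map (z : B →+* ℂ)).IsRoot r) :
    ∃ x : A →ₐ[ℂ] ℂ, (∀ b, x (algebraMap B A b) = z b) ∧ x f = r := by
  have hint : IsIntegral B f := Algebra.IsIntegral.isIntegral f
  have hr' : Polynomial.eval₂ (z : B →+* ℂ) r (minpoly B f) = 0 := by
    rwa [Polynomial.IsRoot, Polynomial.eval_map] at hr
  have : Module.IsTorsionFree B A := inferInstance
  -- Since `B` is integrally closed, `B[f]` is `B[X]` modulo the minimal polynomial of `f`. A root
  -- `r` therefore defines a point of `B[f]` over `z`, which then lifts to `A` by lying over.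
  let e := minpoly.equivAdjoin hint
  let ψ₀ : Algebra.adjoin B {f} →+* ℂ := (AdjoinRoot.lift (z : B →+* ℂ) r hr').comp
    (e.symm : Algebra.adjoin B {f} →+* AdjoinRoot (minpoly B f))
  have hψB : ∀ b, ψ₀ (algebraMap B _ b) = z b := fun b => by
    have : e.symm (algebraMap B _ b) = AdjoinRoot.of _ b := by
      rw [AlgEquiv.commutes]; rfl
    simp [ψ₀, this]
  have hψf : ψ₀ ⟨f, Algebra.self_mem_adjoin_singleton B f⟩ = r := by
    have : e.symm ⟨f, Algebra.self_mem_adjoin_singleton B f⟩ = AdjoinRoot.root _ := by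
      rw [AlgEquiv.symm_apply_eq]
      ext
      simp [e]
    simp [ψ₀, this]
  let ψ : Algebra.adjoin B {f} →ₐ[ℂ] ℂ := { ψ₀ with
    commutes' := fun c => by
      have := hψB (algebraMap ℂ B c)
      rw [AlgHom.commutes] at this
      rw [← this]
      congr 1
      exact IsScalarTower.algebraMap_apply ℂ B _ c }
  have : (RingHom.ker ψ).IsMaximal :=
    RingHom.ker_isMaximal_of_surjective ψ fun c => ⟨algebraMap ℂ _ c, by simp⟩
  have : Algebra.IsIntegral (Algebra.adjoin B {f}) A := Algebra.IsIntegral.tower_top (R := B)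
  obtain ⟨Q, hQ, hQψ⟩ := Ideal.exists_ideal_over_maximal_of_isIntegral (S := A) (RingHom.ker ψ)
    (by
      rw [(RingHom.injective_iff_ker_eq_bot _).1
        (FaithfulSMul.algebraMap_injective (Algebra.adjoin B {f}) A)]
      exact bot_le)
  obtain ⟨x, hx⟩ := exists_algHom_ker_eq Q
  have key : ψ = x.comp (((Algebra.adjoin B {f}).val).restrictScalars ℂ) := by
    refine algHom_eq_of_ker_le fun a ha => ?_
    have ha' : a ∈ Ideal.comap (algebraMap (Algebra.adjoin B {f}) A) Q := by rw [hQψ]; exact ha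
    have : (a : A) ∈ RingHom.ker x := by rw [hx]; exact ha'
    exact this
  refine ⟨x, fun b => ?_, ?_⟩
  · rw [← hψB b]
    exact (DFunLike.congr_fun key (algebraMap B _ b)).symm
  · rw [← hψf]
    exact (DFunLike.congr_fun key ⟨f, Algebra.self_mem_adjoin_singleton B f⟩).symm

end Integral

/-- Finitely many complex points are separated by elements of the algebra. -/
lemma exists_separating {A : Type*} [CommRing A] [Algebra ℂ A] (x₀ : A →ₐ[ℂ] ℂ)
    {F : Set (A →ₐ[ℂ] ℂ)} (hF : F.Finite) :
    ∃ f : A, x₀ f = 0 ∧ ∀ x ∈ F, x f = 0 → x = x₀ := by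
  classical
  have h : ∀ x : A →ₐ[ℂ] ℂ, ∃ g : A, x ≠ x₀ → x g = 0 ∧ x₀ g = 1 := by
    intro x
    by_cases hx : x = x₀
    · exact ⟨0, fun h => absurd hx h⟩
    · obtain ⟨s, hs⟩ := DFunLike.ne_iff.1 hx
      refine ⟨(x₀ s - x s)⁻¹ • (s - algebraMap ℂ A (x s)), fun _ => ⟨by simp, ?_⟩⟩
      simp [inv_mul_cancel₀ (sub_ne_zero.2 hs.symm)]
  choose g hg using h
  -- The product is `1` at `x₀` and `0` at every other point of `F`.
  refine ⟨1 - ∏ x ∈ hF.toFinset.erase x₀, g x, ?_, fun x hx hxf => ?_⟩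
  · rw [map_sub, map_prod, map_one, Finset.prod_eq_one, sub_self]
    exact fun x hx => (hg x (Finset.ne_of_mem_erase hx)).2
  · by_contra hne
    rw [map_sub, map_prod, map_one,
      Finset.prod_eq_zero (i := x) (by simp [hne, hx]) (hg x hne).1] at hxf
    simp at hxf

/-- Up to sign the constant term is the product of the roots, so the smallest root satisfies the
bound. A small constant term thus forces a small root. -/
lemma exists_isRoot_norm_pow_le {p : Polynomial ℂ} (hp : p.Monic) (hd : p.natDegree ≠ 0) :
    ∃ r, p.IsRoot r ∧ ‖r‖ ^ p.natDegree ≤ ‖p.coeff 0‖ := by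
  have hs := IsAlgClosed.splits p
  have hcard := hs.natDegree_eq_card_roots
  have hne : p.roots ≠ 0 := by
    intro h
    rw [h] at hcard
    exact hd (by simpa using hcard)
  have hnorm : ‖p.coeff 0‖ = (p.roots.map fun r => ‖r‖).prod := by
    rw [hs.coeff_zero_eq_prod_roots_of_monic hp, norm_mul, norm_pow, norm_neg, norm_one, one_pow,
      one_mul]
    exact map_multiset_prod (normHom : ℂ →*₀ ℝ) _
  obtain ⟨m, hm, hmin⟩ := Multiset.exists_min_image (fun r : ℂ => ‖r‖) (s := p.roots) hne
  refine ⟨m, (Polynomial.mem_roots hp.ne_zero).1 hm, ?_⟩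
  rw [hnorm, hcard]
  calc ‖m‖ ^ p.roots.card = (p.roots.map fun _ => ‖m‖).prod := by simp
    _ ≤ _ := Multiset.prod_map_le_prod_map₀ _ _ (fun _ _ => norm_nonneg m) hmin

end ComplexPoints

/-! ### Euclidean density of Zariski open sets, and closures of polynomial images -/

section Density

open Filter Topology

lemma norm_le_of_isRoot_of_monic {p : Polynomial ℂ} (hp : p.Monic) {r : ℂ} (hr : p.IsRoot r) :
    ‖r‖ ≤ ∑ i ∈ Finset.range p.natDegree, ‖p.coeff i‖ + 1 := by
  have h := (Polynomial.IsRoot.norm_lt_cauchyBound hp.ne_zero hr).le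
  refine (NNReal.coe_le_coe.2 h).trans ?_
  rw [Polynomial.cauchyBound, hp.leadingCoeff, nnnorm_one, div_one, NNReal.coe_add, NNReal.coe_one]
  gcongr
  have : (Finset.range p.natDegree).sup (fun i => ‖p.coeff i‖₊) ≤
      ∑ i ∈ Finset.range p.natDegree, ‖p.coeff i‖₊ :=
    Finset.sup_le fun i hi =>
      Finset.single_le_sum (f := fun i => ‖p.coeff i‖₊) (fun _ _ => zero_le) hi
  simpa using NNReal.coe_le_coe.2 this

/-- The elements on which the sequence converges form a subalgebra, and a pointwise limit of algebra
maps is an algebra map. -/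
lemma exists_algHom_of_tendsto_generators {A : Type*} [CommRing A] [Algebra ℂ A] {s : Set A}
    (hs : Algebra.adjoin ℂ s = ⊤) (x : ℕ → A →ₐ[ℂ] ℂ)
    (h : ∀ t ∈ s, ∃ l, Tendsto (fun k => x k t) atTop (𝓝 l)) :
    ∃ x' : A →ₐ[ℂ] ℂ, ∀ b, Tendsto (fun k => x k b) atTop (𝓝 (x' b)) := by
  have hall : ∀ b, ∃ l, Tendsto (fun k => x k b) atTop (𝓝 l) := by
    intro b
    have hb : b ∈ Algebra.adjoin ℂ s := hs ▸ Algebra.mem_top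
    induction hb using Algebra.adjoin_induction with
    | mem t ht => exact h t ht
    | algebraMap c => exact ⟨c, by simp⟩
    | add a b _ _ ha hb =>
      obtain ⟨l, hl⟩ := ha
      obtain ⟨m, hm⟩ := hb
      exact ⟨l + m, by simpa using hl.add hm⟩
    | mul a b _ _ ha hb =>
      obtain ⟨l, hl⟩ := ha
      obtain ⟨m, hm⟩ := hb
      exact ⟨l * m, by simpa using hl.mul hm⟩
  choose l hl using hall
  refine ⟨⟨⟨⟨⟨l, ?_⟩, ?_⟩, ?_, ?_⟩, ?_⟩, hl⟩
  · exact tendsto_nhds_unique (hl 1) (by simp)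
  · exact fun a b => tendsto_nhds_unique (hl _) (by simpa using (hl a).mul (hl b))
  · exact tendsto_nhds_unique (hl 0) (by simp)
  · exact fun a b => tendsto_nhds_unique (hl _) (by simpa using (hl a).add (hl b))
  · exact fun c => tendsto_nhds_unique (hl _) (by simp)

/-- Finite maps are proper: values on generators are roots of monic polynomials with convergent
coefficients, hence bounded, and Bolzano–Weierstrass applies. -/
lemma exists_subseq_tendsto_algHom {B A : Type*} [CommRing B] [Algebra ℂ B] [CommRing A]
    [Algebra ℂ A] [Algebra.FiniteType ℂ A] [Algebra B A] [Algebra.IsIntegral B A]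
    (z : ℕ → B →ₐ[ℂ] ℂ) (z₀ : B → ℂ) (hz : ∀ b, Tendsto (fun k => z k b) atTop (𝓝 (z₀ b)))
    (x : ℕ → A →ₐ[ℂ] ℂ) (hx : ∀ k b, x k (algebraMap B A b) = z k b) :
    ∃ (x' : A →ₐ[ℂ] ℂ) (φ : ℕ → ℕ), StrictMono φ ∧
      ∀ b, Tendsto (fun k => x (φ k) b) atTop (𝓝 (x' b)) := by
  obtain ⟨s, hs⟩ := Algebra.FiniteType.out (R := ℂ) (A := A)
  have hbd : ∀ t : A, ∃ C, ∀ k, ‖x k t‖ ≤ C := by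
    intro t
    have hmon := minpoly.monic (Algebra.IsIntegral.isIntegral (R := B) t)
    have hlim : Tendsto (fun k => ∑ i ∈ Finset.range (minpoly B t).natDegree,
        ‖z k ((minpoly B t).coeff i)‖ + 1) atTop
        (𝓝 (∑ i ∈ Finset.range (minpoly B t).natDegree, ‖z₀ ((minpoly B t).coeff i)‖ + 1)) :=
      (tendsto_finsetSum _ fun i _ => (hz _).norm).add_const 1
    obtain ⟨C, hC⟩ := hlim.bddAbove_range
    refine ⟨C, fun k => le_trans ?_ (hC ⟨k, rfl⟩)⟩
    have := norm_le_of_isRoot_of_monic (hmon.map (z k : B →+* ℂ))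
      (isRoot_minpoly_map (z k) (x k) (hx k) t)
    simpa [hmon.natDegree_map] using this
  choose C hC using hbd
  have hb : Bornology.IsBounded (Set.range fun k (t : s) => x k t) := by
    refine isBounded_iff_forall_norm_le.2 ⟨∑ t : s, |C t|, ?_⟩
    rintro _ ⟨k, rfl⟩
    refine (pi_norm_le_iff_of_nonneg (Finset.sum_nonneg fun _ _ => abs_nonneg _)).2 fun t => ?_
    exact ((hC t k).trans (le_abs_self _)).trans
      (Finset.single_le_sum (f := fun t : s => |C t|) (fun _ _ => abs_nonneg _)
        (Finset.mem_univ t))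
  obtain ⟨l, -, φ, hφ, hl⟩ := tendsto_subseq_of_bounded hb (fun k => ⟨k, rfl⟩)
  obtain ⟨x', hx'⟩ := exists_algHom_of_tendsto_generators hs (fun k => x (φ k))
    fun t ht => ⟨l ⟨t, ht⟩, (tendsto_pi_nhds.1 hl) ⟨t, ht⟩⟩
  exact ⟨x', φ, hφ, hx'⟩

/-- A nonzero polynomial cannot vanish on a product of infinite sets, here balls shrinking to `z₀`.
-/
lemma exists_seq_tendsto_eval_ne_zero {d : ℕ} {h : MvPolynomial (Fin d) ℂ} (hh : h ≠ 0)
    (z₀ : Fin d → ℂ) :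
    ∃ z : ℕ → Fin d → ℂ, Tendsto z atTop (𝓝 z₀) ∧ ∀ k, MvPolynomial.eval (z k) h ≠ 0 := by
  have hne : ∀ k : ℕ, ∃ z ∈ Set.univ.pi fun i => Metric.ball (z₀ i) (1 / ((k : ℝ) + 1)),
      MvPolynomial.eval z h ≠ 0 := by
    intro k
    by_contra! hcon
    refine hh (MvPolynomial.funext_set _ (fun i => ?_) (fun z hz => by rw [hcon z hz, map_zero]))
    exact infinite_of_mem_nhds (z₀ i) (Metric.ball_mem_nhds _ (by positivity))
  choose z hz hzh using hne
  refine ⟨z, tendsto_pi_nhds.2 fun i => ?_, hzh⟩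
  rw [tendsto_iff_dist_tendsto_zero]
  exact squeeze_zero (fun _ => dist_nonneg) (fun k => (hz k i trivial).le)
    tendsto_one_div_add_atTop_nhds_zero_nat

/-- The complement of a proper hypersurface in an irreducible affine variety is dense for the
Euclidean topology. -/
theorem exists_seq_algHom_tendsto {A : Type*} [CommRing A] [IsDomain A] [Algebra ℂ A]
    [Algebra.FiniteType ℂ A] {a : A} (ha : a ≠ 0) (x₀ : A →ₐ[ℂ] ℂ) :
    ∃ x : ℕ → A →ₐ[ℂ] ℂ, (∀ k, x k a ≠ 0) ∧
      ∀ b, Tendsto (fun k => x k b) atTop (𝓝 (x₀ b)) := by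
  obtain ⟨d, g, hg, hint⟩ := exists_integral_inj_algHom_of_fg ℂ A
  algebraize [g.toRingHom]
  have : IsScalarTower ℂ (MvPolynomial (Fin d) ℂ) A :=
    IsScalarTower.of_algebraMap_eq fun c => (g.commutes c).symm
  have : FaithfulSMul (MvPolynomial (Fin d) ℂ) A := (faithfulSMul_iff_algebraMap_injective _ _).2 hg
  have : Algebra.IsIntegral (MvPolynomial (Fin d) ℂ) A := ⟨hint⟩
  -- `h` is a nonzero polynomial divisible by `a` in `A`, so a point lying over `h ≠ 0` satisfies `a
  -- ≠ 0`. It remains to lift a sequence `z k → z₀` avoiding `h` to one converging to `x₀`.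
  obtain ⟨h, hha, hh⟩ := Submodule.exists_mem_ne_zero_of_ne_bot
    (Ideal.comap_ne_bot_of_integral_mem (R := MvPolynomial (Fin d) ℂ) ha
      (Ideal.mem_span_singleton_self a) (Algebra.IsIntegral.isIntegral a))
  obtain ⟨c, hc⟩ := Ideal.mem_span_singleton.1 (Ideal.mem_comap.1 hha)
  let z₀ : MvPolynomial (Fin d) ℂ →ₐ[ℂ] ℂ := x₀.comp g
  obtain ⟨ζ, hζ, hζh⟩ := exists_seq_tendsto_eval_ne_zero hh fun i => z₀ (MvPolynomial.X i)
  let z : ℕ → MvPolynomial (Fin d) ℂ →ₐ[ℂ] ℂ := fun k => MvPolynomial.aeval (ζ k)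
  have hz₀ : z₀ = MvPolynomial.aeval fun i => z₀ (MvPolynomial.X i) := by ext; simp
  have hz : ∀ b, Tendsto (fun k => z k b) atTop (𝓝 (z₀ b)) := by
    intro b
    rw [hz₀]
    exact ((MvPolynomial.continuous_eval b).tendsto _).comp hζ
  -- `f` singles out `x₀` in its fibre. As `f` vanishes at `x₀`, the constant term of its minimal
  -- polynomial vanishes at `z₀`, so the polynomial specialised at `z k` has a root `r k` tending to
  -- `0`. Lifts with `f = r k` can then accumulate only at `x₀`.
  obtain ⟨f, hf₀, hf⟩ := exists_separating x₀ (finite_fiber (A := A) z₀)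
  have hmon := minpoly.monic (Algebra.IsIntegral.isIntegral (R := MvPolynomial (Fin d) ℂ) f)
  set p := minpoly (MvPolynomial (Fin d) ℂ) f with hp
  have hdeg : p.natDegree ≠ 0 :=
    (minpoly.natDegree_pos (Algebra.IsIntegral.isIntegral f)).ne'
  have hroot : ∀ k, ∃ r, (p.map (z k : MvPolynomial (Fin d) ℂ →+* ℂ)).IsRoot r ∧
      ‖r‖ ^ p.natDegree ≤ ‖z k (p.coeff 0)‖ := by
    intro k
    obtain ⟨r, hr, hr'⟩ := exists_isRoot_norm_pow_le (hmon.map (z k : MvPolynomial (Fin d) ℂ →+* ℂ))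
      (by rwa [hmon.natDegree_map])
    exact ⟨r, hr, by simpa [hmon.natDegree_map] using hr'⟩
  choose r hr hrle using hroot
  have hp0 : z₀ (p.coeff 0) = 0 := by
    have := isRoot_minpoly_map z₀ x₀ (fun _ => rfl) f
    rw [hf₀, Polynomial.IsRoot, ← Polynomial.coeff_zero_eq_eval_zero, Polynomial.coeff_map] at this
    exact this
  have hr0 : Tendsto r atTop (𝓝 0) := by
    rw [tendsto_zero_iff_norm_tendsto_zero]
    have h1 : Tendsto (fun k => ‖r k‖ ^ p.natDegree) atTop (𝓝 0) := by
      refine squeeze_zero (fun _ => by positivity) hrle ?_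
      simpa [hp0] using (hz (p.coeff 0)).norm
    refine squeeze_zero' (.of_forall fun _ => norm_nonneg _) (g := fun k =>
      (‖r k‖ ^ p.natDegree) ^ ((p.natDegree : ℝ)⁻¹)) (.of_forall fun k => ?_) ?_
    · exact (Real.pow_rpow_inv_natCast (norm_nonneg _) hdeg).ge
    · have := h1.rpow_const (p := (p.natDegree : ℝ)⁻¹) (.inr (by positivity))
      rwa [Real.zero_rpow (by positivity)] at this
  choose x hxB hxf using fun k => exists_algHom_of_isRoot_minpoly (z k) f (r k) (hr k)
  obtain ⟨x', φ, hφ, hx'⟩ := exists_subseq_tendsto_algHom z z₀ hz x hxB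
  have hx'0 : x' = x₀ := by
    refine hf x' (fun b => ?_) ?_
    · refine tendsto_nhds_unique (hx' _) ?_
      simpa only [hxB, Function.comp_def] using (hz b).comp hφ.tendsto_atTop
    · refine tendsto_nhds_unique (hx' _) ?_
      simpa only [hxf, Function.comp_def] using hr0.comp hφ.tendsto_atTop
  refine ⟨fun k => x (φ k), fun k hk => hζh (φ k) ?_, hx'0 ▸ hx'⟩
  have : x (φ k) (algebraMap _ A h) = 0 := by rw [hc, map_mul, hk, zero_mul]
  rw [hxB] at this
  exact this

/-- The Euclidean closure of the image of an affine variety under a polynomial map contains its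
Zariski closure. -/
theorem mem_closure_image_of_forall_eval_eq_zero {σ τ : Type*} [Finite σ] [Finite τ]
    (I : Ideal (MvPolynomial σ ℂ)) (F : τ → MvPolynomial σ ℂ) (y : τ → ℂ)
    (hy : ∀ P : MvPolynomial τ ℂ,
      (∀ x ∈ MvPolynomial.zeroLocus ℂ I,
        MvPolynomial.eval (fun j => MvPolynomial.eval x (F j)) P = 0) →
      MvPolynomial.eval y P = 0) :
    y ∈ closure ((fun x j => MvPolynomial.eval x (F j)) '' MvPolynomial.zeroLocus ℂ I) := by
  let π : MvPolynomial τ ℂ →ₐ[ℂ] MvPolynomial σ ℂ ⧸ I :=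
    (Ideal.Quotient.mkₐ ℂ I).comp (MvPolynomial.aeval F)
  let m : Ideal (MvPolynomial τ ℂ) := RingHom.ker (MvPolynomial.aeval (R := ℂ) y)
  have : m.IsPrime := RingHom.ker_isPrime _
  have hle : Ideal.comap (π : MvPolynomial τ ℂ →+* MvPolynomial σ ℂ ⧸ I) ⊥ ≤ m := by
    intro P hP
    have hP' : MvPolynomial.aeval F P ∈ I := Ideal.Quotient.eq_zero_iff_mem.1 hP
    refine hy P fun x hx => ?_
    have := hx _ hP'
    rw [← MvPolynomial.coe_aeval_eq_eval] at *
    rw [← AlgHom.comp_apply, MvPolynomial.comp_aeval] at this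
    exact this
  -- `q` is an irreducible component, through `y`, of the Zariski closure of the image. Being
  -- minimal over the kernel of `π`, it is the contraction of a prime `p` of the source, which
  -- reduces the claim to an injective map of domains.
  obtain ⟨q, hq, hqm⟩ := Ideal.exists_minimalPrimes_le hle
  obtain ⟨p, hp, -, hpq⟩ := Ideal.exists_comap_eq_of_mem_minimalPrimes _ q hq
  have hqp : q.IsPrime := hpq ▸ inferInstance
  let A := MvPolynomial τ ℂ ⧸ q
  let S := (MvPolynomial σ ℂ ⧸ I) ⧸ p
  let f : A →ₐ[ℂ] S := Ideal.quotientMapₐ p π hpq.ge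
  have hf : Function.Injective f := Ideal.quotientMap_injective' (H := hpq.ge) hpq.le
  obtain ⟨a, ha, hlift⟩ := exists_ne_zero_forall_exists_lift (A := A) (S := S) f hf
  let x₀ : A →ₐ[ℂ] ℂ := Ideal.Quotient.liftₐ q (MvPolynomial.aeval y) fun b hb => hqm hb
  obtain ⟨x, hxa, hx⟩ := exists_seq_algHom_tendsto ha x₀
  choose ξ hξ using fun k => hlift (x k) (hxa k)
  let ω : MvPolynomial σ ℂ →ₐ[ℂ] S := (Ideal.Quotient.mkₐ ℂ p).comp (Ideal.Quotient.mkₐ ℂ I)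
  have hω : ∀ k b, ξ k (ω b) = MvPolynomial.aeval (fun i => ξ k (ω (MvPolynomial.X i))) b := by
    intro k b
    rw [← AlgHom.comp_apply]
    congr 1
    ext
    simp
  refine mem_closure_of_tendsto (f := fun k j => x k (Ideal.Quotient.mk q (MvPolynomial.X j)))
    (tendsto_pi_nhds.2 fun j => ?_) (.of_forall fun k => ?_) (b := atTop)
  · have := hx (Ideal.Quotient.mk q (MvPolynomial.X j))
    rwa [show x₀ (Ideal.Quotient.mk q (MvPolynomial.X j)) = y j from
      MvPolynomial.aeval_X y j] at this
  · refine ⟨fun i => ξ k (ω (MvPolynomial.X i)), fun b hb => ?_, ?_⟩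
    · rw [← hω]
      have : ω b = 0 := by
        refine (congrArg (Ideal.Quotient.mk p) (Ideal.Quotient.eq_zero_iff_mem.2 hb)).trans ?_
        exact map_zero _
      rw [this, map_zero]
    · funext j
      have h1 : f (Ideal.Quotient.mk q (MvPolynomial.X j)) = ω (F j) :=
        congrArg ω (MvPolynomial.aeval_X F j)
      rw [← hξ k, AlgHom.comp_apply, h1, hω]
      rfl

end Density

variable {n : Type} [Fintype n] [DecidableEq n] {G : Subgroup (Matrix.SpecialLinearGroup n ℂ)}

/-! ### The classical groups are Zariski closed -/

section ZariskiClosed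

/-- The entries of a matrix, as a point of affine space. -/
def entries (A : Matrix n n ℂ) : n × n → ℂ := fun ij => A ij.1 ij.2

variable (G) in
/-- `G` is the zero locus of an ideal of polynomials in the matrix entries. -/
def IsZariskiClosed : Prop :=
  ∃ I : Ideal (MvPolynomial (n × n) ℂ), ∀ x : n × n → ℂ,
    x ∈ MvPolynomial.zeroLocus ℂ I ↔
      ∃ g : G, entries ((g : Matrix.SpecialLinearGroup n ℂ) : Matrix n n ℂ) = x

lemma mem_zeroLocus_span {σ : Type*} {S : Set (MvPolynomial σ ℂ)} {x : σ → ℂ} :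
    x ∈ MvPolynomial.zeroLocus ℂ (Ideal.span S) ↔ ∀ P ∈ S, MvPolynomial.eval x P = 0 := by
  rw [MvPolynomial.mem_zeroLocus_iff, ← MvPolynomial.coe_aeval_eq_eval]
  refine ⟨fun h P hP => h P (Ideal.subset_span hP), fun h P hP => ?_⟩
  have : Ideal.span S ≤ RingHom.ker (MvPolynomial.aeval (R := ℂ) x) := Ideal.span_le.2 h
  exact this hP

lemma map_eval_entries (A : Matrix n n ℂ) :
    (Matrix.mvPolynomialX n n ℂ).map (MvPolynomial.eval (entries A)) = A :=
  Matrix.mvPolynomialX_mapMatrix_eval A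

/-- A subgroup of `SL n ℂ` cut out by a polynomial matrix equation is Zariski closed. -/
lemma isZariskiClosed_of_forall_mem_iff (M : Matrix n n (MvPolynomial (n × n) ℂ))
    (hM : ∀ g : Matrix.SpecialLinearGroup n ℂ,
      g ∈ G ↔ M.map (MvPolynomial.eval (entries (g : Matrix n n ℂ))) = 0) :
    IsZariskiClosed G := by
  have hdet : ∀ A : Matrix n n ℂ, MvPolynomial.eval (entries A)
      ((Matrix.mvPolynomialX n n ℂ).det - 1) = A.det - 1 := fun A => by
    rw [map_sub, map_one, RingHom.map_det, RingHom.mapMatrix_apply, map_eval_entries]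
  refine ⟨Ideal.span (insert ((Matrix.mvPolynomialX n n ℂ).det - 1)
    (Set.range fun ij : n × n => M ij.1 ij.2)), fun x => ?_⟩
  rw [mem_zeroLocus_span]
  constructor
  · intro h
    let A : Matrix n n ℂ := Matrix.of fun i j => x (i, j)
    have hx : entries A = x := rfl
    have h1 : A.det = 1 := by
      have := h _ (Set.mem_insert _ _)
      rwa [← hx, hdet, sub_eq_zero] at this
    refine ⟨⟨⟨A, h1⟩, (hM _).2 ?_⟩, hx⟩
    ext i j
    exact h _ (Set.mem_insert_of_mem _ ⟨(i, j), rfl⟩)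
  · rintro ⟨g, rfl⟩ P (rfl | ⟨ij, rfl⟩)
    · rw [hdet, Matrix.SpecialLinearGroup.det_coe, sub_self]
    · exact congrFun (congrFun ((hM _).1 g.2) ij.1) ij.2

lemma IsClassicalGroup.isZariskiClosed (hG : IsClassicalGroup G) : IsZariskiClosed G := by
  have orth : ∀ k : ℕ, IsZariskiClosed (specialOrthogonal (Fin k)) := fun k => by
    refine isZariskiClosed_of_forall_mem_iff
      (Matrix.mvPolynomialX _ _ ℂ * (Matrix.mvPolynomialX _ _ ℂ).transpose - 1) fun g => ?_
    rw [Matrix.map_sub _ (fun _ _ => map_sub _ _ _), Matrix.map_mul, Matrix.transpose_map,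
      map_eval_entries, Matrix.map_one _ (map_zero _) (map_one _), sub_eq_zero]
    exact Matrix.mem_orthogonalGroup_iff (Fin k) ℂ
  induction hG with
  | sl N => exact isZariskiClosed_of_forall_mem_iff 0 fun g => by simp
  | soEven N _ => exact orth _
  | soOdd N => exact orth _
  | sp N _ =>
    refine isZariskiClosed_of_forall_mem_iff
      (Matrix.mvPolynomialX _ _ ℂ * (Matrix.J (Fin N) ℂ).map MvPolynomial.C *
        (Matrix.mvPolynomialX _ _ ℂ).transpose - (Matrix.J (Fin N) ℂ).map MvPolynomial.C) fun g => ?_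
    have hJ : ((Matrix.J (Fin N) ℂ).map MvPolynomial.C).map
        (MvPolynomial.eval (entries (g : Matrix (Fin N ⊕ Fin N) (Fin N ⊕ Fin N) ℂ))) =
        Matrix.J (Fin N) ℂ := by
      ext i j
      simp only [Matrix.map_apply, MvPolynomial.eval_C]
    rw [Matrix.map_sub _ (fun _ _ => map_sub _ _ _), Matrix.map_mul, Matrix.map_mul,
      Matrix.transpose_map, map_eval_entries, hJ, sub_eq_zero]
    exact SymplecticGroup.mem_iff

/-- Guarantees that the identity matrix is nonzero. -/
lemma IsClassicalGroup.nonempty (hG : IsClassicalGroup G) : Nonempty n := by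
  induction hG with
  | sl N => infer_instance
  | soEven N hN => exact ⟨⟨0, by omega⟩⟩
  | soOdd N => infer_instance
  | sp N hN => exact ⟨.inl ⟨0, hN⟩⟩

end ZariskiClosed

/-! ### Semistable pairs and boundedness of the ratio of norms -/

section Semistable

open Filter Topology

lemma _root_.MvPolynomial.IsHomogeneous.eval_mul {σ : Type*} {P : MvPolynomial σ ℂ} {d : ℕ}
    (hP : P.IsHomogeneous d) (t : ℂ) (x : σ → ℂ) :
    MvPolynomial.eval (fun i => t * x i) P = t ^ d * MvPolynomial.eval x P := by
  rw [MvPolynomial.eval_eq, MvPolynomial.eval_eq, Finset.mul_sum]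
  refine Finset.sum_congr rfl fun s hs => ?_
  simp only [mul_pow]
  rw [Finset.prod_mul_distrib, Finset.prod_pow_eq_pow_sum, ← hP.degree_eq_sum_deg_support hs]
  ring

/-- On the line through `x`, `P` is a polynomial in `t` whose coefficients are the values at `x` of
its homogeneous components. This passes from polynomials vanishing on a cone to the homogeneous ones
that define projective closures. -/
lemma eval_homogeneousComponent_eq_zero {σ : Type*} (P : MvPolynomial σ ℂ) (x : σ → ℂ)
    (h : ∀ t : ℂ, MvPolynomial.eval (fun i => t * x i) P = 0) (d : ℕ) :
    MvPolynomial.eval x (MvPolynomial.homogeneousComponent d P) = 0 := by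
  let q : Polynomial ℂ := ∑ k ∈ Finset.range (P.totalDegree + 1),
    Polynomial.monomial k (MvPolynomial.eval x (MvPolynomial.homogeneousComponent k P))
  have hq : q = 0 := Polynomial.funext fun t => by
    rw [Polynomial.eval_zero, ← h t]
    conv_rhs => rw [← MvPolynomial.sum_homogeneousComponent P]
    simp only [q, Polynomial.eval_finsetSum, Polynomial.eval_monomial, map_sum]
    refine Finset.sum_congr rfl fun k _ => ?_
    rw [(MvPolynomial.homogeneousComponent_isHomogeneous k P).eval_mul, mul_comm]
  by_cases hd : P.totalDegree < d
  · rw [MvPolynomial.homogeneousComponent_eq_zero _ _ hd, map_zero]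
  · have := congrArg (fun p => Polynomial.coeff p d) hq
    simpa [q, Polynomial.finsetSum_coeff, Polynomial.coeff_monomial, not_lt.1 hd,
      Nat.lt_succ_iff] using this

/-! ### Homogeneous polynomials and limits in projective space -/

section ZariskiClosure

variable {E : Type*} [AddCommGroup E] [Module ℂ E]

lemma eval_smul_dual {P : MvPolynomial (Module.Dual ℂ E) ℂ} {d : ℕ} (hP : P.IsHomogeneous d)
    (t : ℂ) (u : E) :
    MvPolynomial.eval (fun φ => φ (t • u)) P = t ^ d * MvPolynomial.eval (fun φ => φ u) P := by
  simp only [map_smul, smul_eq_mul]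
  exact hP.eval_mul t fun φ => φ u

lemma eval_rep_mk_eq_zero_iff {P : MvPolynomial (Module.Dual ℂ E) ℂ} {d : ℕ}
    (hP : P.IsHomogeneous d) {u : E} (hu : u ≠ 0) :
    MvPolynomial.eval (fun φ => φ (Projectivization.mk ℂ u hu).rep) P = 0 ↔
      MvPolynomial.eval (fun φ => φ u) P = 0 := by
  obtain ⟨a, ha⟩ := Projectivization.exists_smul_eq_mk_rep ℂ u hu
  rw [← ha, Units.smul_def, eval_smul_dual hP]
  simp

/-- A homogeneous polynomial vanishing at `e k` vanishes at every multiple, hence at the limit. As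
`E` carries no topology, convergence is tested on linear forms. -/
lemma mem_zariskiClosure_of_tendsto {S : Set (ℙ ℂ E)} {u : E} (hu : u ≠ 0) (e : ℕ → E)
    (t : ℕ → ℂ) (he : ∀ k, ∃ h : e k ≠ 0, Projectivization.mk ℂ (e k) h ∈ S)
    (hlim : ∀ φ : Module.Dual ℂ E, Tendsto (fun k => φ (t k • e k)) atTop (𝓝 (φ u))) :
    Projectivization.mk ℂ u hu ∈ zariskiClosure S := by
  intro d P hP hS
  rw [eval_rep_mk_eq_zero_iff hP]
  have h1 : Tendsto (fun k => MvPolynomial.eval (fun φ : Module.Dual ℂ E => φ (t k • e k)) P) atTop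
      (𝓝 (MvPolynomial.eval (fun φ => φ u) P)) :=
    ((MvPolynomial.continuous_eval P).tendsto _).comp (tendsto_pi_nhds.2 hlim)
  refine tendsto_nhds_unique h1 (tendsto_const_nhds.congr fun k => ?_)
  obtain ⟨h, hk⟩ := he k
  rw [eval_smul_dual hP, (eval_rep_mk_eq_zero_iff hP h).1 (hS _ hk), mul_zero]

end ZariskiClosure

variable {V W : Type*} [AddCommGroup V] [Module ℂ V] [AddCommGroup W] [Module ℂ W]
  {ι κ : Type*} [Fintype ι] [Fintype κ]

lemma tendsto_apply_prod (b : Module.Basis ι ℂ V) (c : Module.Basis κ ℂ W) {x : ℕ → V} {y : ℕ → W}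
    {x₀ : V} {y₀ : W} (hx : Tendsto (fun k => b.equivFun (x k)) atTop (𝓝 (b.equivFun x₀)))
    (hy : Tendsto (fun k => c.equivFun (y k)) atTop (𝓝 (c.equivFun y₀)))
    (φ : Module.Dual ℂ (V × W)) :
    Tendsto (fun k => φ (x k, y k)) atTop (𝓝 (φ (x₀, y₀))) := by
  let ψ : (ι → ℂ) × (κ → ℂ) →ₗ[ℂ] ℂ :=
    φ ∘ₗ (b.equivFun.symm.toLinearMap.prodMap c.equivFun.symm.toLinearMap)
  have hψ : Continuous ψ := ψ.continuous_of_finiteDimensional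
  have := (hψ.tendsto (b.equivFun x₀, c.equivFun y₀)).comp (hx.prodMk_nhds hy)
  simpa [ψ, Function.comp_def] using this

lemma apply_ne_zero {V : Type*} [AddCommGroup V] [Module ℂ V] (ρ : Representation ℂ G V) (g : G)
    {v : V} (hv : v ≠ 0) : ρ g v ≠ 0 := fun h => hv <| by
  have : ρ g⁻¹ (ρ g v) = v := by rw [← Module.End.mul_apply, ← map_mul]; simp
  rw [← this, h, map_zero]

/-- If the pair is semistable, the ratio of norms is bounded below along the orbit. -/
lemma exists_le_norm_of_isSemistablePair {ρ : Representation ℂ G V} {τ : Representation ℂ G W}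
    {v : V} {w : W} (hv : v ≠ 0) (b : Module.Basis ι ℂ V) (c : Module.Basis κ ℂ W)
    (h : IsSemistablePair ρ τ v w) :
    ∃ C : ℝ, 0 < C ∧ ∀ g : G, C * ‖b.equivFun (ρ g v)‖ ≤ ‖c.equivFun (τ g w)‖ := by
  by_contra! hcon
  -- With the constants `1 / (k + 1)`, rescaling the `V`-component to norm one sends the
  -- `W`-component to zero, while compactness of the sphere gives a limit `a` in `V`.
  choose g hg using fun k : ℕ => hcon (1 / ((k : ℝ) + 1)) (by positivity)
  have hgv : ∀ g : G, ρ g v ≠ 0 := fun g => apply_ne_zero ρ g hv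
  set r : ℕ → ℝ := fun k => ‖b.equivFun (ρ (g k) v)‖ with hr
  have hr0 : ∀ k, 0 < r k := fun k => norm_pos_iff.2 (by simpa using hgv (g k))
  let t : ℕ → ℂ := fun k => ((r k)⁻¹ : ℝ)
  have ht : ∀ k, ‖t k‖ = (r k)⁻¹ := fun k => by
    simp [t, abs_of_pos (hr0 k)]
  obtain ⟨l, hl, φ, hφ, hlim⟩ := (isCompact_sphere (0 : ι → ℂ) 1).tendsto_subseq
    (x := fun k => b.equivFun (t k • ρ (g k) v)) fun k => by
      rw [mem_sphere_zero_iff_norm, map_smul, norm_smul, ht]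
      exact inv_mul_cancel₀ (hr0 k).ne'
  have hw : Tendsto (fun k => c.equivFun (t k • τ (g k) w)) atTop (𝓝 0) := by
    rw [tendsto_zero_iff_norm_tendsto_zero]
    refine squeeze_zero (fun _ => norm_nonneg _) (fun k => ?_)
      tendsto_one_div_add_atTop_nhds_zero_nat
    rw [map_smul, norm_smul, ht, inv_mul_le_iff₀ (hr0 k), mul_comm]
    exact (hg k).le
  let a := b.equivFun.symm l
  have ha : a ≠ 0 := by
    intro ha
    have : l = 0 := by
      rw [← b.equivFun.apply_symm_apply l]
      exact (congrArg _ ha).trans (map_zero _)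
    simp [this] at hl
  have hu : ((a, 0) : V × W) ≠ 0 := by simpa using ha
  have hx : Tendsto (fun k => b.equivFun (t (φ k) • ρ (g (φ k)) v)) atTop (𝓝 (b.equivFun a)) := by
    rw [b.equivFun.apply_symm_apply l]
    exact hlim
  have hmem : Projectivization.mk ℂ ((a, 0) : V × W) hu ∈
      zariskiClosure (projectiveOrbit (ρ.prod τ) (v, w)) ∩
        zariskiClosure (projectiveOrbit (ρ.prod τ) (v, 0)) := by
    refine ⟨mem_zariskiClosure_of_tendsto hu (fun k => (ρ (g (φ k)) v, τ (g (φ k)) w))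
      (fun k => t (φ k)) (fun k => ?_) (fun ψ => ?_),
      mem_zariskiClosure_of_tendsto hu (fun k => (ρ (g (φ k)) v, 0))
      (fun k => t (φ k)) (fun k => ?_) (fun ψ => ?_)⟩
    · have hne : (ρ (g (φ k)) v, τ (g (φ k)) w) ≠ 0 := fun h => hgv _ (congrArg Prod.fst h)
      exact ⟨hne, g (φ k), hne, rfl⟩
    · exact tendsto_apply_prod b c hx (by rw [map_zero]; exact hw.comp hφ.tendsto_atTop) ψ
    · have hne : ((ρ (g (φ k)) v, 0) : V × W) ≠ 0 := fun h => hgv _ (congrArg Prod.fst h)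
      have heq : (ρ.prod τ) (g (φ k)) (v, 0) = (ρ (g (φ k)) v, 0) := by simp
      exact ⟨hne, g (φ k), heq ▸ hne, by simp only [heq]⟩
    · exact tendsto_apply_prod b c hx (by simp) ψ
  rw [IsSemistablePair] at h
  rw [h] at hmem
  exact hmem

/-- If the ratio of norms is bounded below along the orbit, the pair is semistable. -/
lemma isSemistablePair_of_le_norm (hG : IsZariskiClosed G) {ρ : Representation ℂ G V}
    {τ : Representation ℂ G W} {v : V} {w : W}
    (b : Module.Basis ι ℂ V) (c : Module.Basis κ ℂ W)
    (hρ : ∀ i, ∃ P : MvPolynomial (n × n) ℂ, ∀ g : G, b.equivFun (ρ g v) i = evalEntries P g)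
    (hτ : ∀ j, ∃ P : MvPolynomial (n × n) ℂ, ∀ g : G, c.equivFun (τ g w) j = evalEntries P g)
    {C : ℝ} (hC : 0 < C) (h : ∀ g : G, C * ‖b.equivFun (ρ g v)‖ ≤ ‖c.equivFun (τ g w)‖) :
    IsSemistablePair ρ τ v w := by
  classical
  rw [IsSemistablePair, Set.eq_empty_iff_forall_notMem]
  rintro y ⟨hy1, hy2⟩
  induction y using Projectivization.ind with | h u hu => ?_
  obtain ⟨a, z⟩ := u
  let coords : V × W → ι ⊕ κ → ℂ := fun u => Sum.elim (b.equivFun u.1) (c.equivFun u.2)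
  let D : ι ⊕ κ → Module.Dual ℂ (V × W) := Sum.elim
    (fun i => b.coord i ∘ₗ LinearMap.fst ℂ V W) (fun j => c.coord j ∘ₗ LinearMap.snd ℂ V W)
  have hD : ∀ u, (fun i => D i u) = coords u := fun u => by
    funext i; cases i <;> simp [D, coords]
  -- Linear forms on `W` vanish on `G · [(v, 0)]`, hence on its closure.
  have hz : z = 0 := by
    refine c.ext_elem fun j => ?_
    have hX := MvPolynomial.isHomogeneous_X ℂ (D (Sum.inr j))
    have := (eval_rep_mk_eq_zero_iff hX hu).1 (hy2 1 _ hX (by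
      rintro _ ⟨g, hne, rfl⟩
      rw [eval_rep_mk_eq_zero_iff hX]
      simp [D]))
    simpa [D] using this
  subst hz
  have ha : a ≠ 0 := fun ha => hu (by simp [ha])
  choose P hP using hρ
  choose Q hQ using hτ
  obtain ⟨I, hI⟩ := hG
  -- The extra variable `none` is a scaling factor, so the image of `F` on `ℂ × G` is the affine
  -- cone over the orbit.
  let F : ι ⊕ κ → MvPolynomial (Option (n × n)) ℂ := fun i =>
    MvPolynomial.X none * MvPolynomial.rename some (Sum.elim P Q i)
  have hF : ∀ (t : ℂ) (g : G), (fun i => MvPolynomial.eval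
      (fun o => Option.elim o t (entries ((g : Matrix.SpecialLinearGroup n ℂ) : Matrix n n ℂ)))
      (F i)) = fun i => t * coords (ρ g v, τ g w) i := by
    intro t g
    funext i
    cases i with
    | inl i =>
      simp only [F, coords, map_mul, MvPolynomial.eval_X, MvPolynomial.eval_rename, Sum.elim_inl, hP]
      rfl
    | inr j =>
      simp only [F, coords, map_mul, MvPolynomial.eval_X, MvPolynomial.eval_rename, Sum.elim_inr, hQ]
      rfl
  let J : Ideal (MvPolynomial (Option (n × n)) ℂ) := I.map (MvPolynomial.rename some).toRingHom
  have hJ : ∀ x : Option (n × n) → ℂ, x ∈ MvPolynomial.zeroLocus ℂ J ↔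
      ∃ (t : ℂ) (g : G), x = fun o => Option.elim o t
        (entries ((g : Matrix.SpecialLinearGroup n ℂ) : Matrix n n ℂ)) := by
    intro x
    have h1 : x ∈ MvPolynomial.zeroLocus ℂ J ↔ (x ∘ some) ∈ MvPolynomial.zeroLocus ℂ I := by
      rw [show J = Ideal.span _ from rfl, mem_zeroLocus_span, MvPolynomial.mem_zeroLocus_iff]
      simp [MvPolynomial.eval_rename, MvPolynomial.aeval_eq_eval]
    rw [h1, hI]
    constructor
    · rintro ⟨g, hg⟩
      refine ⟨x none, g, funext fun o => ?_⟩
      cases o with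
      | none => rfl
      | some o => exact (congrFun hg o).symm
    · rintro ⟨t, g, rfl⟩
      exact ⟨g, rfl⟩
  have key := mem_closure_image_of_forall_eval_eq_zero J F (coords (a, 0)) fun R hR => by
    rw [← MvPolynomial.sum_homogeneousComponent R, map_sum]
    refine Finset.sum_eq_zero fun d _ => ?_
    have hhom : (MvPolynomial.rename D (MvPolynomial.homogeneousComponent d R)).IsHomogeneous d :=
      (MvPolynomial.homogeneousComponent_isHomogeneous d R).rename_isHomogeneous
    have hren : ∀ u, MvPolynomial.eval (fun φ : Module.Dual ℂ (V × W) => φ u)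
        (MvPolynomial.rename D (MvPolynomial.homogeneousComponent d R)) =
        MvPolynomial.eval (coords u) (MvPolynomial.homogeneousComponent d R) := fun u => by
      rw [MvPolynomial.eval_rename, ← hD]; rfl
    rw [← hren, ← eval_rep_mk_eq_zero_iff hhom hu]
    refine hy1 d _ hhom ?_
    rintro _ ⟨g, hne, rfl⟩
    rw [eval_rep_mk_eq_zero_iff hhom, hren]
    refine eval_homogeneousComponent_eq_zero R _ (fun t => ?_) d
    have := hR _ ((hJ _).2 ⟨t, g, rfl⟩)
    rw [hF] at this
    exact this
  -- This closed condition is invariant under scaling, so it holds on the cone and then at `(a, 0)`,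
  -- where it reads `C ‖a‖ ≤ 0`.
  have hclosed : IsClosed {x : ι ⊕ κ → ℂ | C * ‖fun i => x (Sum.inl i)‖ ≤
      ‖fun j => x (Sum.inr j)‖} :=
    isClosed_le (by fun_prop) (by fun_prop)
  have hle := hclosed.closure_subset_iff.2 ?_ key
  · have h0 : C * ‖b.equivFun a‖ ≤ 0 := by
      refine hle.trans_eq ?_
      change ‖c.equivFun 0‖ = 0
      rw [map_zero, norm_zero]
    have h1 : 0 < ‖b.equivFun a‖ := norm_pos_iff.2 (by simpa using ha)
    exact absurd h0 (not_le.2 (mul_pos hC h1))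
  · rintro _ ⟨x, hx, rfl⟩
    obtain ⟨t, g, rfl⟩ := (hJ x).1 hx
    have hl := congrFun (hF t g)
    simp only [Set.mem_ofPred_eq, hl]
    change C * ‖t • b.equivFun (ρ g v)‖ ≤ ‖t • c.equivFun (τ g w)‖
    rw [norm_smul, norm_smul]
    nlinarith [mul_le_mul_of_nonneg_left (h g) (norm_nonneg t)]

/-- A pair is semistable if and only if its energy is bounded below. -/
theorem isSemistablePair_iff (hG : IsZariskiClosed G) {ρ : Representation ℂ G V}
    {τ : Representation ℂ G W} {v : V} {w : W} (hv : v ≠ 0)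
    (b : Module.Basis ι ℂ V) (c : Module.Basis κ ℂ W)
    (hρ : ∀ i, ∃ P : MvPolynomial (n × n) ℂ, ∀ g : G, b.equivFun (ρ g v) i = evalEntries P g)
    (hτ : ∀ j, ∃ P : MvPolynomial (n × n) ℂ, ∀ g : G, c.equivFun (τ g w) j = evalEntries P g) :
    IsSemistablePair ρ τ v w ↔
      ∃ C : ℝ, 0 < C ∧ ∀ g : G, C * ‖b.equivFun (ρ g v)‖ ≤ ‖c.equivFun (τ g w)‖ :=
  ⟨exists_le_norm_of_isSemistablePair hv b c,
    fun ⟨_, hC, h⟩ => isSemistablePair_of_le_norm hG b c hρ hτ hC h⟩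

end Semistable

/-! ### Norms of tensor powers -/

section TensorNorms

variable {V W : Type*} [AddCommGroup V] [Module ℂ V] [AddCommGroup W] [Module ℂ W]
  {ι κ : Type*} [Fintype ι] [Fintype κ]

lemma exists_norm_eq_apply [Nonempty ι] (x : ι → ℂ) : ∃ i, ‖x‖ = ‖x i‖ := by
  obtain ⟨i, -, hi⟩ := Finset.exists_mem_eq_sup Finset.univ Finset.univ_nonempty fun i => ‖x i‖₊
  exact ⟨i, by rw [Pi.norm_def, hi, coe_nnnorm]⟩

/-- The maximum is attained at the constant tuple on a largest coordinate. -/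
lemma norm_prod_apply_eq_pow (x : ι → ℂ) (m : ℕ) :
    ‖fun p : Fin m → ι => ∏ k, x (p k)‖ = ‖x‖ ^ m := by
  refine le_antisymm ((pi_norm_le_iff_of_nonneg (by positivity)).2 fun p => ?_) ?_
  · rw [norm_prod]
    refine (Finset.prod_le_prod (fun _ _ => norm_nonneg _)
      fun k _ => norm_le_pi_norm x (p k)).trans ?_
    simp
  · cases isEmpty_or_nonempty ι with
    | inl h =>
      -- For empty `ι` and `m = 0` the one empty tuple has product `1`, matching `0 ^ 0 = 1`.
      cases m with
      | zero => simp
      | succ m => simp [Subsingleton.elim x 0]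
    | inr h =>
      obtain ⟨i, hi⟩ := exists_norm_eq_apply x
      simpa [hi] using norm_le_pi_norm (fun p : Fin m → ι => ∏ k, x (p k)) fun _ => i

lemma norm_mul_apply_eq_mul (x : ι → ℂ) (y : κ → ℂ) :
    ‖fun p : ι × κ => x p.1 * y p.2‖ = ‖x‖ * ‖y‖ := by
  refine le_antisymm ((pi_norm_le_iff_of_nonneg (by positivity)).2 fun p => ?_) ?_
  · rw [norm_mul]
    exact mul_le_mul (norm_le_pi_norm x _) (norm_le_pi_norm y _) (norm_nonneg _) (norm_nonneg _)
  · cases isEmpty_or_nonempty ι with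
    | inl h => simp [Subsingleton.elim x 0]
    | inr h =>
      cases isEmpty_or_nonempty κ with
      | inl h => simp [Subsingleton.elim y 0]
      | inr h =>
        obtain ⟨i, hi⟩ := exists_norm_eq_apply x
        obtain ⟨j, hj⟩ := exists_norm_eq_apply y
        rw [hi, hj, ← norm_mul]
        exact norm_le_pi_norm (fun p : ι × κ => x p.1 * y p.2) (i, j)

/-- The basis of the tensor power induced by a basis. -/
def powerBasis (b : Module.Basis ι ℂ V) (m : ℕ) : Module.Basis (Fin m → ι) ℂ (⨂[ℂ]^m V) :=
  Basis.piTensorProduct fun _ : Fin m => b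

lemma powerBasis_equivFun (b : Module.Basis ι ℂ V) (m : ℕ) (v : V) :
    (powerBasis b m).equivFun (vectorPower v m) = fun p => ∏ k, b.equivFun v (p k) := by
  funext p
  exact Basis.piTensorProduct_repr_tprod_apply _ _ _

lemma norm_powerBasis_equivFun (b : Module.Basis ι ℂ V) (m : ℕ) (v : V) :
    ‖(powerBasis b m).equivFun (vectorPower v m)‖ = ‖b.equivFun v‖ ^ m := by
  rw [powerBasis_equivFun, norm_prod_apply_eq_pow]

lemma tensorProduct_equivFun {V W : Type*} [AddCommMonoid V] [Module ℂ V] [AddCommMonoid W]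
    [Module ℂ W] (b : Module.Basis ι ℂ V) (c : Module.Basis κ ℂ W) (v : V) (w : W) :
    (b.tensorProduct c).equivFun (v ⊗ₜ[ℂ] w) = fun p => b.equivFun v p.1 * c.equivFun w p.2 := by
  funext p
  rw [Module.Basis.equivFun_apply, Module.Basis.tensorProduct_repr_tmul_apply, smul_eq_mul, mul_comm]
  rfl

lemma norm_tensorProduct_equivFun {V W : Type*} [AddCommMonoid V] [Module ℂ V] [AddCommMonoid W]
    [Module ℂ W] (b : Module.Basis ι ℂ V) (c : Module.Basis κ ℂ W) (v : V)
    (w : W) : ‖(b.tensorProduct c).equivFun (v ⊗ₜ[ℂ] w)‖ = ‖b.equivFun v‖ * ‖c.equivFun w‖ := by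
  rw [tensorProduct_equivFun, norm_mul_apply_eq_mul]

lemma ne_zero_of_norm_equivFun_pos {V : Type*} [AddCommMonoid V] [Module ℂ V]
    (b : Module.Basis ι ℂ V) {v : V} (h : 0 < ‖b.equivFun v‖) :
    v ≠ 0 := by
  rintro rfl
  simp at h

lemma norm_equivFun_pos (b : Module.Basis ι ℂ V) {v : V} (hv : v ≠ 0) : 0 < ‖b.equivFun v‖ := by
  rw [norm_pos_iff, Ne, LinearEquiv.map_eq_zero_iff]
  exact hv

lemma tensorPower_apply_vectorPower (ρ : Representation ℂ G V) (m : ℕ) (g : G) (v : V) :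
    tensorPower ρ m g (vectorPower v m) = vectorPower (ρ g v) m := by
  simp [tensorPower, vectorPower]

lemma exists_evalEntries_powerBasis {b : Module.Basis ι ℂ V} {ρ : Representation ℂ G V} {v : V}
    (h : ∀ i, ∃ P : MvPolynomial (n × n) ℂ, ∀ g : G, b.equivFun (ρ g v) i = evalEntries P g)
    (m : ℕ) (p : Fin m → ι) : ∃ P : MvPolynomial (n × n) ℂ, ∀ g : G,
      (powerBasis b m).equivFun (tensorPower ρ m g (vectorPower v m)) p = evalEntries P g := by
  choose P hP using h
  refine ⟨∏ k, P (p k), fun g => ?_⟩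
  rw [tensorPower_apply_vectorPower, powerBasis_equivFun, evalEntries, map_prod]
  exact Finset.prod_congr rfl fun k _ => hP _ g

lemma exists_evalEntries_tensorProduct {b : Module.Basis ι ℂ V} {c : Module.Basis κ ℂ W}
    {ρ : Representation ℂ G V} {τ : Representation ℂ G W} {v : V} {w : W}
    (hρ : ∀ i, ∃ P : MvPolynomial (n × n) ℂ, ∀ g : G, b.equivFun (ρ g v) i = evalEntries P g)
    (hτ : ∀ j, ∃ P : MvPolynomial (n × n) ℂ, ∀ g : G, c.equivFun (τ g w) j = evalEntries P g)
    (p : ι × κ) : ∃ P : MvPolynomial (n × n) ℂ, ∀ g : G,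
      (b.tensorProduct c).equivFun ((ρ.tprod τ) g (v ⊗ₜ[ℂ] w)) p = evalEntries P g := by
  obtain ⟨P, hP⟩ := hρ p.1
  obtain ⟨Q, hQ⟩ := hτ p.2
  refine ⟨P * Q, fun g => ?_⟩
  rw [Representation.tprod_apply, TensorProduct.map_tmul, tensorProduct_equivFun, evalEntries,
    map_mul]
  exact congrArg₂ (· * ·) (hP g) (hQ g)

lemma stdBasis_equivFun (A : Matrix n n ℂ) : (Matrix.stdBasis ℂ n n).equivFun A = entries A := by
  apply (Matrix.stdBasis ℂ n n).equivFun.symm.injective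
  rw [LinearEquiv.symm_apply_apply, Module.Basis.equivFun_symm_apply]
  conv_lhs => rw [Matrix.matrix_eq_sum_single A]
  rw [Fintype.sum_prod_type]
  simp [entries, Matrix.stdBasis_eq_single]

lemma leftRegular_apply_one (g : G) : leftRegular G g (1 : Matrix n n ℂ) =
    ((g : Matrix.SpecialLinearGroup n ℂ) : Matrix n n ℂ) := by
  simp [leftRegular]

/-- Semistability of the pair `(I ^ q ⊗ v ^ m, w ^ l)` in terms of coordinates. -/
lemma isSemistablePair_power_iff (hG : IsZariskiClosed G) [Nonempty n]
    {ρ : Representation ℂ G V} {τ : Representation ℂ G W} (hρ : IsRational ρ) (hτ : IsRational τ)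
    {v : V} (hv : v ≠ 0) (w : W) (b : Module.Basis ι ℂ V) (c : Module.Basis κ ℂ W) (q m l : ℕ) :
    IsSemistablePair ((tensorPower (leftRegular G) q).tprod (tensorPower ρ m)) (tensorPower τ l)
      (vectorPower (1 : Matrix n n ℂ) q ⊗ₜ[ℂ] vectorPower v m) (vectorPower w l) ↔
    ∃ C : ℝ, 0 < C ∧ ∀ g : G,
      C * (‖entries ((g : Matrix.SpecialLinearGroup n ℂ) : Matrix n n ℂ)‖ ^ q *
        ‖b.equivFun (ρ g v)‖ ^ m) ≤ ‖c.equivFun (τ g w)‖ ^ l := by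
  have hne : vectorPower (1 : Matrix n n ℂ) q ⊗ₜ[ℂ] vectorPower v m ≠ 0 := by
    refine ne_zero_of_norm_equivFun_pos
      ((powerBasis (Matrix.stdBasis ℂ n n) q).tensorProduct (powerBasis b m)) ?_
    rw [norm_tensorProduct_equivFun, norm_powerBasis_equivFun, norm_powerBasis_equivFun]
    have := norm_equivFun_pos (Matrix.stdBasis ℂ n n) one_ne_zero
    have := norm_equivFun_pos b hv
    positivity
  refine (isSemistablePair_iff hG hne
    ((powerBasis (Matrix.stdBasis ℂ n n) q).tensorProduct (powerBasis b m)) (powerBasis c l)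
    ?_ ?_).trans ?_
  · refine exists_evalEntries_tensorProduct (exists_evalEntries_powerBasis (fun ij => ?_) q)
      (exists_evalEntries_powerBasis (fun i => hρ (b.coord i) v) m)
    refine ⟨MvPolynomial.X ij, fun g => ?_⟩
    rw [leftRegular_apply_one, stdBasis_equivFun]
    simp [evalEntries, entries]
  · exact exists_evalEntries_powerBasis (fun i => hτ (c.coord i) w) l
  · refine exists_congr fun C => and_congr_right fun _ => forall_congr' fun g => ?_
    rw [Representation.tprod_apply, TensorProduct.map_tmul, tensorPower_apply_vectorPower,
      tensorPower_apply_vectorPower, tensorPower_apply_vectorPower, norm_tensorProduct_equivFun,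
      norm_powerBasis_equivFun, norm_powerBasis_equivFun, norm_powerBasis_equivFun,
      leftRegular_apply_one, stdBasis_equivFun]

end TensorNorms

/-! ### Equivalence of norms -/

section NormEquivalence

lemma exists_norm_equivFun_le {V : Type*} [NormedAddCommGroup V] [NormedSpace ℂ V]
    {ι : Type*} [Fintype ι] (b : Module.Basis ι ℂ V) :
    ∃ k K : ℝ, 0 < k ∧ 0 < K ∧ ∀ v, k * ‖v‖ ≤ ‖b.equivFun v‖ ∧ ‖b.equivFun v‖ ≤ K * ‖v‖ := by
  let e := b.equivFunL
  obtain ⟨K, hK, hK'⟩ := e.toContinuousLinearMap.bound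
  obtain ⟨k, hk, hk'⟩ := e.symm.toContinuousLinearMap.bound
  refine ⟨k⁻¹, K, inv_pos.2 hk, hK, fun v => ⟨?_, hK' v⟩⟩
  rw [inv_mul_le_iff₀ hk]
  have h := hk' (e v)
  rwa [show e.symm.toContinuousLinearMap (e v) = v from e.symm_apply_apply v] at h

/-- By homogeneity it suffices to take the minimum and maximum of `f` on the compact unit sphere. -/
lemma exists_norm_sq_le_of_pos {ι : Type*} [Fintype ι] {f : (ι → ℂ) → ℝ} (hf : Continuous f)
    (hsmul : ∀ (r : ℝ) x, f ((r : ℂ) • x) = r ^ 2 * f x) (hpos : ∀ x, x ≠ 0 → 0 < f x) :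
    ∃ k K : ℝ, 0 < k ∧ 0 < K ∧ ∀ x, k * ‖x‖ ^ 2 ≤ f x ∧ f x ≤ K * ‖x‖ ^ 2 := by
  have hf0 : f 0 = 0 := by simpa using hsmul 0 0
  have hS := isCompact_sphere (0 : ι → ℂ) 1
  rcases (Metric.sphere (0 : ι → ℂ) 1).eq_empty_or_nonempty with hE | hE
  · refine ⟨1, 1, one_pos, one_pos, fun x => ?_⟩
    have : x = 0 := by
      by_contra hx
      have : ((‖x‖⁻¹ : ℝ) : ℂ) • x ∈ Metric.sphere (0 : ι → ℂ) 1 := by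
        simp [norm_smul, hx]
      simp [hE] at this
    simp [this, hf0]
  · obtain ⟨x₁, hx₁, hmin⟩ := hS.exists_isMinOn hE hf.continuousOn
    obtain ⟨x₂, hx₂, hmax⟩ := hS.exists_isMaxOn hE hf.continuousOn
    have hne : ∀ x ∈ Metric.sphere (0 : ι → ℂ) 1, x ≠ 0 := fun x hx =>
      Metric.ne_of_mem_sphere hx one_ne_zero
    refine ⟨f x₁, f x₂, hpos _ (hne _ hx₁), hpos _ (hne _ hx₂), fun x => ?_⟩
    by_cases hx : x = 0
    · simp [hx, hf0]
    have hmem : ((‖x‖⁻¹ : ℝ) : ℂ) • x ∈ Metric.sphere (0 : ι → ℂ) 1 := by simp [norm_smul, hx]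
    have hx' : f x = f (((‖x‖⁻¹ : ℝ) : ℂ) • x) * ‖x‖ ^ 2 := by
      rw [hsmul, inv_pow, mul_comm (_⁻¹), mul_assoc, inv_mul_cancel₀ (by positivity), mul_one]
    rw [hx']
    exact ⟨by gcongr; exact hmin hmem, by gcongr; exact hmax hmem⟩

lemma hsNormSq_pos {H A : Matrix n n ℂ} (hH : H.PosDef) (hA : A ≠ 0) : 0 < hsNormSq H A := by
  open scoped MatrixOrder in
  obtain ⟨B, hB⟩ := CStarAlgebra.nonneg_iff_eq_star_mul_self.mp hH.posSemidef.nonneg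
  rw [Matrix.star_eq_conjTranspose] at hB
  have hdet : IsUnit (B.conjTranspose.det * B.det) := by
    rw [← Matrix.det_mul, ← hB]
    exact (Matrix.isUnit_iff_isUnit_det _).1 hH.isUnit
  have hB1 : IsUnit B.det := isUnit_of_mul_isUnit_right hdet
  have hB2 : IsUnit B.conjTranspose.det := isUnit_of_mul_isUnit_left hdet
  -- With `H = Bᴴ B`, conjugation by `B` turns the `H`-adjoint into the usual one, so the trace
  -- becomes that of `Dᴴ D`.
  set D := B * A * B⁻¹ with hD
  have htr : (H⁻¹ * A.conjTranspose * H * A).trace = (D.conjTranspose * D).trace := by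
    have h1 : D.conjTranspose * D =
        (B.conjTranspose)⁻¹ * A.conjTranspose * B.conjTranspose * B * A * B⁻¹ := by
      rw [hD, Matrix.conjTranspose_mul, Matrix.conjTranspose_mul, Matrix.conjTranspose_nonsing_inv]
      simp only [Matrix.mul_assoc]
    rw [h1, Matrix.trace_mul_comm _ B⁻¹, hB, Matrix.mul_inv_rev]
    simp only [Matrix.mul_assoc]
  have hD0 : D ≠ 0 := by
    intro h
    apply hA
    have : A = B⁻¹ * D * B := by
      rw [hD]
      simp only [Matrix.mul_assoc, Matrix.nonsing_inv_mul _ hB1, Matrix.mul_one]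
      rw [← Matrix.mul_assoc, Matrix.nonsing_inv_mul _ hB1, Matrix.one_mul]
    rw [this, h, Matrix.mul_zero, Matrix.zero_mul]
  have hpos : 0 < (D.conjTranspose * D).trace :=
    lt_of_le_of_ne (Matrix.posSemidef_conjTranspose_mul_self D).trace_nonneg
      fun h => hD0 (Matrix.trace_conjTranspose_mul_self_eq_zero_iff.1 h.symm)
  rw [hsNormSq, htr]
  exact (Complex.lt_def.1 hpos).1

lemma exists_norm_entries_sq_le_hsNormSq {H : Matrix n n ℂ} (hH : H.PosDef) :
    ∃ k K : ℝ, 0 < k ∧ 0 < K ∧ ∀ A : Matrix n n ℂ,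
      k * ‖entries A‖ ^ 2 ≤ hsNormSq H A ∧ hsNormSq H A ≤ K * ‖entries A‖ ^ 2 := by
  let M : (n × n → ℂ) → Matrix n n ℂ := fun x => Matrix.of fun i j => x (i, j)
  have hM : Continuous M := by
    refine continuous_matrix fun i j => ?_
    exact continuous_apply (i, j)
  have hcont : Continuous fun x => hsNormSq H (M x) := by
    unfold hsNormSq
    fun_prop
  have hsmul : ∀ (r : ℝ) x, hsNormSq H (M ((r : ℂ) • x)) = r ^ 2 * hsNormSq H (M x) := by
    intro r x
    have : M ((r : ℂ) • x) = (r : ℂ) • M x := rfl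
    simp only [hsNormSq, this, Matrix.conjTranspose_smul, Matrix.mul_smul, Matrix.smul_mul,
      Matrix.trace_smul, smul_eq_mul]
    simp [sq, mul_assoc]
  obtain ⟨k, K, hk, hK, h⟩ := exists_norm_sq_le_of_pos hcont hsmul fun x hx =>
    hsNormSq_pos hH fun h => hx (funext fun ij => congrFun (congrFun h ij.1) ij.2)
  exact ⟨k, K, hk, hK, fun A => h (entries A)⟩

end NormEquivalence

/-! ### Properness of the energy -/

section Proper

/-- Bridges the unsquared coordinate norms of semistability and the squared Hermitian norms of the
energy. -/
lemma exists_pos_mul_le_iff_of_sq_comparable {X : Type*} {f f' g g' : X → ℝ} {K₁ K₂ K₃ K₄ : ℝ}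
    (h₁ : 0 < K₁) (h₂ : 0 < K₂) (h₃ : 0 < K₃) (h₄ : 0 < K₄) (hf : ∀ x, 0 ≤ f x)
    (hg : ∀ x, 0 ≤ g x) (hf₁ : ∀ x, f' x ≤ K₁ * f x ^ 2) (hg₁ : ∀ x, g x ^ 2 ≤ K₂ * g' x)
    (hf₂ : ∀ x, f x ^ 2 ≤ K₃ * f' x) (hg₂ : ∀ x, g' x ≤ K₄ * g x ^ 2) :
    (∃ C : ℝ, 0 < C ∧ ∀ x, C * f x ≤ g x) ↔ ∃ C : ℝ, 0 < C ∧ ∀ x, C * f' x ≤ g' x := by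
  constructor
  · rintro ⟨C, hC, h⟩
    refine ⟨C ^ 2 / (K₁ * K₂), by positivity, fun x => ?_⟩
    have h5 : (C * f x) ^ 2 ≤ g x ^ 2 := pow_le_pow_left₀ (mul_nonneg hC.le (hf x)) (h x) 2
    rw [div_mul_eq_mul_div, div_le_iff₀ (by positivity)]
    calc C ^ 2 * f' x ≤ C ^ 2 * (K₁ * f x ^ 2) := by gcongr; exact hf₁ x
      _ = K₁ * (C * f x) ^ 2 := by ring
      _ ≤ K₁ * (K₂ * g' x) := mul_le_mul_of_nonneg_left (h5.trans (hg₁ x)) h₁.le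
      _ = g' x * (K₁ * K₂) := by ring
  · rintro ⟨C, hC, h⟩
    refine ⟨Real.sqrt (C / (K₃ * K₄)), Real.sqrt_pos.2 (by positivity), fun x => ?_⟩
    refine (sq_le_sq₀ (mul_nonneg (Real.sqrt_nonneg _) (hf x)) (hg x)).1 ?_
    rw [mul_pow, Real.sq_sqrt (by positivity), div_mul_eq_mul_div, div_le_iff₀ (by positivity)]
    calc C * f x ^ 2 ≤ C * (K₃ * f' x) := by gcongr; exact hf₂ x
      _ = K₃ * (C * f' x) := by ring
      _ ≤ K₃ * (K₄ * g x ^ 2) := mul_le_mul_of_nonneg_left ((h x).trans (hg₂ x)) h₃.le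
      _ = g x ^ 2 * (K₃ * K₄) := by ring

/-- Multiply by `m + 1` and exponentiate: the coefficient of `log (y ^ 2)` becomes `1 - (m + 1) =
-m`. -/
lemma log_inequality_iff {x y h : ℝ} (hx : 0 < x) (hy : 0 < y) (hh : 0 < h) (q m : ℕ) (B : ℝ) :
    Real.log (x ^ 2) - Real.log (y ^ 2) + 1 / ((m : ℝ) + 1) * Real.log (y ^ 2) ≥
        (q : ℝ) / ((m : ℝ) + 1) * Real.log h + B ↔
      Real.exp (((m : ℝ) + 1) * B) * (h ^ q * (y ^ 2) ^ m) ≤ (x ^ 2) ^ (m + 1) := by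
  have hm : (0 : ℝ) < (m : ℝ) + 1 := by positivity
  rw [← Real.log_le_log_iff (by positivity) (by positivity), Real.log_mul (by positivity)
    (by positivity), Real.log_exp, Real.log_mul (by positivity) (by positivity), Real.log_pow h q,
    Real.log_pow (y ^ 2) m, Real.log_pow (x ^ 2) (m + 1), ge_iff_le, ← mul_le_mul_iff_right₀ hm]
  have e1 : ((m : ℝ) + 1) * ((q : ℝ) / ((m : ℝ) + 1) * Real.log h + B) =
      q * Real.log h + ((m : ℝ) + 1) * B := by field_simp
  have e2 : ((m : ℝ) + 1) * (Real.log (x ^ 2) - Real.log (y ^ 2) +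
      1 / ((m : ℝ) + 1) * Real.log (y ^ 2)) =
      ((m : ℝ) + 1) * Real.log (x ^ 2) - m * Real.log (y ^ 2) := by field_simp; ring
  rw [e1, e2]
  push_cast
  constructor <;> intro h <;> linarith

variable {V W : Type*} [NormedAddCommGroup V] [InnerProductSpace ℂ V]
  [NormedAddCommGroup W] [InnerProductSpace ℂ W]

lemma isProperEnergy_iff [Nonempty n] {H : Matrix n n ℂ} (hH : H.PosDef)
    (ρ : Representation ℂ G V) (τ : Representation ℂ G W) {v : V} (hv : v ≠ 0) {w : W}
    (hw : w ≠ 0) :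
    IsProperEnergy H ρ τ v w ↔ ∃ m : ℕ, 0 < m ∧ ∃ C : ℝ, 0 < C ∧ ∀ g : G,
      C * (hsNormSq H ((g : Matrix.SpecialLinearGroup n ℂ) : Matrix n n ℂ) ^ degree ρ *
        (‖ρ g v‖ ^ 2) ^ m) ≤ (‖τ g w‖ ^ 2) ^ (m + 1) := by
  refine exists_congr fun m => and_congr_right fun _ => ?_
  have hpos : ∀ g : G, 0 < hsNormSq H ((g : Matrix.SpecialLinearGroup n ℂ) : Matrix n n ℂ) :=
    fun g => hsNormSq_pos hH fun h => by
      have := (g : Matrix.SpecialLinearGroup n ℂ).det_coe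
      rw [h, Matrix.det_zero] at this
      exact zero_ne_one this
  have key := fun (g : G) (B : ℝ) => log_inequality_iff (norm_pos_iff.2 (apply_ne_zero τ g hw))
    (norm_pos_iff.2 (apply_ne_zero ρ g hv)) (hpos g) (degree ρ) m B
  have hm : (0 : ℝ) < (m : ℝ) + 1 := by positivity
  constructor
  · rintro ⟨B, hB⟩
    exact ⟨_, Real.exp_pos _, fun g => (key g B).1 (hB g)⟩
  · rintro ⟨C, hC, h⟩
    refine ⟨Real.log C / ((m : ℝ) + 1), fun g => (key g _).2 ?_⟩
    rw [mul_div_cancel₀ _ hm.ne', Real.exp_log hC]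
    exact h g

lemma exists_le_norm_equivFun_iff {ι κ : Type*} [Fintype ι] [Fintype κ] {H : Matrix n n ℂ}
    (hH : H.PosDef) (ρ : Representation ℂ G V) (τ : Representation ℂ G W) (v : V) (w : W)
    (b : Module.Basis ι ℂ V) (c : Module.Basis κ ℂ W) (q m l : ℕ) :
    (∃ C : ℝ, 0 < C ∧ ∀ g : G,
      C * (‖entries ((g : Matrix.SpecialLinearGroup n ℂ) : Matrix n n ℂ)‖ ^ q *
        ‖b.equivFun (ρ g v)‖ ^ m) ≤ ‖c.equivFun (τ g w)‖ ^ l) ↔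
    ∃ C : ℝ, 0 < C ∧ ∀ g : G,
      C * (hsNormSq H ((g : Matrix.SpecialLinearGroup n ℂ) : Matrix n n ℂ) ^ q *
        (‖ρ g v‖ ^ 2) ^ m) ≤ (‖τ g w‖ ^ 2) ^ l := by
  obtain ⟨k₁, K₁, hk₁, hK₁, h₁⟩ := exists_norm_entries_sq_le_hsNormSq hH
  obtain ⟨k₂, K₂, hk₂, hK₂, h₂⟩ := exists_norm_equivFun_le b
  obtain ⟨k₃, K₃, hk₃, hK₃, h₃⟩ := exists_norm_equivFun_le c
  have hs0 : ∀ A : Matrix n n ℂ, 0 ≤ hsNormSq H A := fun A =>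
    (by positivity : 0 ≤ k₁ * ‖entries A‖ ^ 2).trans (h₁ A).1
  have hlow : ∀ {k s t : ℝ}, 0 < k → k * s ≤ t → s ≤ k⁻¹ * t := fun hk h => by
    rwa [le_inv_mul_iff₀ hk]
  refine exists_pos_mul_le_iff_of_sq_comparable (K₁ := K₁ ^ q * ((k₂⁻¹) ^ 2) ^ m)
    (K₂ := (K₃ ^ 2) ^ l) (K₃ := (k₁⁻¹) ^ q * (K₂ ^ 2) ^ m) (K₄ := ((k₃⁻¹) ^ 2) ^ l)
    (by positivity) (by positivity) (by positivity) (by positivity)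
    (fun g => by positivity) (fun g => by positivity) (fun g => ?_) (fun g => ?_) (fun g => ?_)
    (fun g => ?_)
  · calc
      _ ≤ (K₁ * ‖entries ((g : Matrix.SpecialLinearGroup n ℂ) : Matrix n n ℂ)‖ ^ 2) ^ q *
          ((k₂⁻¹ * ‖b.equivFun (ρ g v)‖) ^ 2) ^ m := by
        gcongr
        · exact hs0 _
        · exact (h₁ _).2
        · exact hlow hk₂ (h₂ _).1
      _ = _ := by ring
  · calc
      _ ≤ ((K₃ * ‖τ g w‖) ^ l) ^ 2 := by
        gcongr
        exact (h₃ _).2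
      _ = _ := by ring
  · calc
      _ = (‖entries ((g : Matrix.SpecialLinearGroup n ℂ) : Matrix n n ℂ)‖ ^ 2) ^ q *
          (‖b.equivFun (ρ g v)‖ ^ 2) ^ m := by ring
      _ ≤ (k₁⁻¹ * hsNormSq H ((g : Matrix.SpecialLinearGroup n ℂ) : Matrix n n ℂ)) ^ q *
          ((K₂ * ‖ρ g v‖) ^ 2) ^ m := by
        gcongr
        · exact pow_nonneg (mul_nonneg (inv_nonneg.2 hk₁.le) (hs0 _)) q
        · exact hlow hk₁ (h₁ _).1
        · exact (h₂ _).2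
      _ = _ := by ring
  · calc
      _ ≤ ((k₃⁻¹ * ‖c.equivFun (τ g w)‖) ^ 2) ^ l := by
        gcongr
        exact hlow hk₃ (h₃ _).1
      _ = _ := by ring

end Proper

end StablePair

end

theorem mainTheorem5 {n : Type} [Fintype n] [DecidableEq n]
    (G : Subgroup (Matrix.SpecialLinearGroup n ℂ)) (hG : StablePair.IsClassicalGroup G)
    {V W : Type*} [NormedAddCommGroup V] [InnerProductSpace ℂ V] [FiniteDimensional ℂ V]
    [NormedAddCommGroup W] [InnerProductSpace ℂ W] [FiniteDimensional ℂ W]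
    (ρ : Representation ℂ G V) (hρ : StablePair.IsRational ρ)
    (τ : Representation ℂ G W) (hτ : StablePair.IsRational τ)
    (v : V) (hv : v ≠ 0) (w : W) (hw : w ≠ 0)
    (H : Matrix n n ℂ) (hH : H.PosDef) :
    StablePair.IsStablePair ρ τ v w ↔ StablePair.IsProperEnergy H ρ τ v w := by
  have := hG.nonempty
  rw [StablePair.isProperEnergy_iff hH ρ τ hv hw]
  -- The same `m` serves both sides; only the constant changes.
  refine exists_congr fun m => and_congr_right fun _ => ?_
  exact (StablePair.isSemistablePair_power_iff hG.isZariskiClosed hρ hτ hv w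
    (Module.finBasis ℂ V) (Module.finBasis ℂ W) _ m (m + 1)).trans
    (StablePair.exists_le_norm_equivFun_iff hH ρ τ v w _ _ _ m (m + 1))
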